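/- Let $G$ be a finite connected graph (loops and parallel edges allowed) with a 2-cell embedding in a closed surface, orientable or not, such that every vertex has degree $4$ and every face is bounded by a closed walk of length exactly $4$ (a 4-regular quadrangulation). Then the surface has Euler characteristic $0$, i.e. it is the torus or the Klein bottle. Moreover, orient the edges of $G$ so that every straight-ahead walk (a walk that, at each vertex, leaves along the edge opposite in the local rotation to the edge by which it arrived) is directed. Then the cop number of the resulting digraph is at most $319$. Here, in the game of cops and robbers on a digraph, the cops choose initial vertices, then the robber chooses his; afterwards the cops and the robber move alternately, the cops first, where in a move each piece either stays or follows an arc out of its vertex; the cops win if one of them reaches the vertex of the robber; and the cop number is the least number of cops that can guarantee a win. -/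

import Mathlib

/-! ### Cops and robbers on digraphs -/

namespace CopsRobber

universe u

variable {V : Type u}

/-- A legal move of a cop or of the robber: stay, or follow an arc. -/
def Move (G : Digraph V) (u v : V) : Prop := v = u ∨ G.Adj u v

/-- `WinFrom G c r`: it is the cops' turn, cop `i` is at `c i`, the robber is at `r`, and the cops
can force, in finitely many rounds, that some cop is on the vertex of the robber. -/
inductive WinFrom (G : Digraph V) {k : ℕ} : (Fin k → V) → V → Prop
  /-- The robber is already caught. -/
  | caught {c : Fin k → V} {r : V} (i : Fin k) (h : c i = r) : WinFrom G c r
  /-- The cops move and one of them reaches the robber. -/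
  | capture {c : Fin k → V} {r : V} (c' : Fin k → V) (hc : ∀ i, Move G (c i) (c' i))
      (i : Fin k) (h : c' i = r) : WinFrom G c r
  /-- The cops move, and they win whatever the robber answers. -/
  | round {c : Fin k → V} {r : V} (c' : Fin k → V) (hc : ∀ i, Move G (c i) (c' i))
      (h : ∀ r', Move G r r' → WinFrom G c' r') : WinFrom G c r

/-- `k` cops can guarantee the capture of the robber: they choose their initial vertices (several
may share a vertex), then the robber chooses his, then the players alternate, the cops first. -/
def CopsWin (G : Digraph V) (k : ℕ) : Prop :=
  ∃ c : Fin k → V, ∀ r : V, WinFrom G c r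

/-- The cop number: the least number of cops that can guarantee the capture of the robber
(`⊤` if no finite number can). -/
noncomputable def copNumber (G : Digraph V) : ℕ∞ :=
  ⨅ (k : ℕ) (_ : CopsWin G k), (k : ℕ∞)

end CopsRobber

/-! ### Graphs cellularly embedded in closed surfaces -/

/-- A finite connected graph (loops and parallel edges allowed) with a 2-cell embedding in a closed
surface, orientable or not, given by its flags. A flag is a mutually incident triple of an end of
an edge, a side of that edge, and the corresponding corner: it is one of the triangles of the
barycentric subdivision of the embedding, and it determines a vertex, an edge and a face. The three
maps send a flag to the flag across each of its sides: the one that differs from it only in the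
vertex, only in the edge, or only in the face. -/
structure SurfaceMap (F : Type*) where
  /-- The flag at the other end of the same edge, on the same side of that edge. -/
  flipV : F → F
  /-- The flag at the same vertex and corner, on the other edge of that corner. -/
  flipE : F → F
  /-- The flag at the same end of the same edge, on the other side of that edge. -/
  flipF : F → F
  flipV_flipV : ∀ x, flipV (flipV x) = x
  flipE_flipE : ∀ x, flipE (flipE x) = x
  flipF_flipF : ∀ x, flipF (flipF x) = x
  /-- The surface has no boundary: across each side of a flag lies another flag. -/
  flipV_ne : ∀ x, flipV x ≠ x
  flipE_ne : ∀ x, flipE x ≠ x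
  flipF_ne : ∀ x, flipF x ≠ x
  /-- Each edge has two ends and two sides: it carries exactly four flags. -/
  flipV_flipF : ∀ x, flipV (flipF x) = flipF (flipV x)
  flipV_ne_flipF : ∀ x, flipV x ≠ flipF x
  /-- The surface is closed (compact), -/
  finite : Finite F
  /-- nonempty, -/
  nonempty : Nonempty F
  /-- and connected. -/
  connected : ∀ x y, Relation.ReflTransGen
    (fun a b => b = flipV a ∨ b = flipE a ∨ b = flipF a) x y

namespace SurfaceMap

variable {F : Type*} (M : SurfaceMap F)

/-- The vertices: classes of flags that are linked without changing the vertex. -/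
def Vertex : Type _ := Quot (fun a b : F => b = M.flipE a ∨ b = M.flipF a)

/-- The edges: classes of flags that are linked without changing the edge. -/
def Edge : Type _ := Quot (fun a b : F => b = M.flipV a ∨ b = M.flipF a)

/-- The faces: classes of flags that are linked without changing the face. -/
def Face : Type _ := Quot (fun a b : F => b = M.flipV a ∨ b = M.flipE a)

/-- The vertex of a flag. -/
def vertex (x : F) : M.Vertex := Quot.mk _ x

/-- The rotation around the vertex of a flag: pass to the other side of its edge, then across the
corner there to the next edge. -/
def rotate (x : F) : F := M.flipE (M.flipF x)

/-- One step along the boundary of the face of a flag: pass to the other end of its edge, then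
across the corner there to the next edge of the facial walk. -/
def faceStep (x : F) : F := M.flipE (M.flipV x)

/-- Every vertex has degree four (a loop counts twice): the rotation around the vertex first returns
to the edge end and side it started from after exactly four steps. -/
def IsFourRegular : Prop := ∀ x, Function.minimalPeriod M.rotate x = 4

/-- Every face is bounded by a closed walk of length exactly four. -/
def IsQuadrangulation : Prop := ∀ x, Function.minimalPeriod M.faceStep x = 4

/-- The Euler characteristic of the surface. -/
noncomputable def eulerChar : ℤ :=
  (Nat.card M.Vertex : ℤ) - Nat.card M.Edge + Nat.card M.Face

/-- Going straight ahead in a four-regular embedded graph: traverse the edge of the flag `x` starting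
at the vertex of `x`; at its other end take the edge that is opposite in the local rotation, two
steps away from the edge just traversed. The result is a flag at that other end. -/
def straightAhead (x : F) : F := M.rotate (M.rotate (M.flipV x))

/-- An orientation of the edges: `out x` says that the edge of the flag `x` is directed away from
the end of the edge at which `x` lies. This does not depend on the side of the edge, and it holds at
exactly one of the two ends. -/
structure Orientation where
  out : F → Prop
  out_flipF : ∀ x, out (M.flipF x) ↔ out x
  out_flipV : ∀ x, out (M.flipV x) ↔ ¬ out x

namespace Orientation

variable {M}

/-- A straight-ahead orientation: every straight-ahead walk that starts along the direction of an
edge goes along the direction of all its edges. -/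
def IsStraightAhead (o : M.Orientation) : Prop :=
  ∀ x, o.out x → ∀ n : ℕ, o.out (M.straightAhead^[n] x)

/-- The digraph obtained by orienting the edges of the embedded graph. -/
def toDigraph (o : M.Orientation) : Digraph M.Vertex where
  Adj u v := ∃ x, o.out x ∧ M.vertex x = u ∧ M.vertex (M.flipV x) = v

end Orientation

end SurfaceMap

/-!
Every vertex and every face has eight flags and every edge has four, so the Euler characteristic is
zero. Translating flags along the two edges of their corner gives two commuting permutations, because
the rotations around vertices and faces have order four; they turn the embedded graph into a quotient
of the square grid `ℤ × ℤ`. A straight-ahead orientation lifts to an orientation of the grid in which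
each row and each column is directed, periodically (`SurfaceMap.coveringGrid`). The cops may play on
the grid, where they can replace a position by a congruent one, and there nine of them win
(`OrientedGrid.copsWin_nine`). Suppose that the robber can escape.

* Two cops pursue him along directed walks. The length of a shortest walk to the robber does not grow
  during the game, and it drops if he stays. One pursuer aims beside the robber, at the column he has
  left by his last horizontal move, if that column has the same direction as the one he is in. Then
  the pursuit becomes shorter if the robber makes a *detour*: a horizontal move, followed by vertical
  moves and by the reverse horizontal move, between two columns of the same direction. So in a
  position with the shortest possible pursuit the robber always moves and never makes a detour
  (`exists_evasion_of_pursuers`).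
* Two adjacent rows of opposite directions form a road, on which a cop can follow every horizontal
  move of the robber, being in his column or one step behind. The cop has to change rows when the
  robber turns back. For this the robber needs a vertical move. If the column of this move does not
  allow the cop to change rows, then the column before it does, where the cop is still standing,
  since otherwise the robber makes a detour. If it does allow the change, then the vertical move
  gives the cop the time to catch up. So the robber cannot cross the road (`RoadGuard.keep`).
* A guard starts when the robber enters the column of a waiting cop. Three cops can force this, since
  two waiting cops confine the robber to the columns between them and a third cop cuts this range
  into smaller ones (`Evasion.exists_aligned`). Hence the robber can be confined between closer and
  closer guarded roads, until all rows between two guards have the same direction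
  (`Evasion.not_of_card`). From then on a cop in any such row can stay in the column of the robber,
  and in the same way single rows are guarded until no row is left (`Evasion.not_of_row`).

The strategies are expressed by sets of positions in which the robber can remain for ever
(`Evasion`): committing a cop to a strategy shrinks such a set.
-/

/-! ### Periodically oriented grids -/

/-- A periodic orientation of the square grid `ℤ × ℤ`: row `y` is directed by `row y = ±1` and
column `x` by `col x = ±1`, both with period `n`. -/
structure OrientedGrid where
  row : ℤ → ℤ
  col : ℤ → ℤ
  n : ℕ
  n_pos : 0 < n
  row_eq : ∀ y, row y = 1 ∨ row y = -1
  col_eq : ∀ x, col x = 1 ∨ col x = -1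
  row_periodic : Function.Periodic row (n : ℤ)
  col_periodic : Function.Periodic col (n : ℤ)

namespace OrientedGrid

variable (G : OrientedGrid)

/-- A move on the grid: stay, or follow the row or the column in its direction. -/
def Move (p p' : ℤ × ℤ) : Prop :=
  p' = p ∨ p' = (p.1 + G.row p.2, p.2) ∨ p' = (p.1, p.2 + G.col p.1)

/-- Congruence modulo the period in both coordinates: two lifts of one vertex of the torus. -/
def Cong (p p' : ℤ × ℤ) : Prop := ∃ a b : ℤ, p' = (p.1 + a * G.n, p.2 + b * G.n)

/-- `Walk m p q`: one can go from `p` to `q` in `m` moves, some of which may be stays. -/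
def Walk : ℕ → ℤ × ℤ → ℤ × ℤ → Prop
  | 0, p, q => p = q
  | m + 1, p, q => ∃ p', G.Move p p' ∧ Walk m p' q

variable {G}

theorem row_add_mul (y a : ℤ) : G.row (y + a * G.n) = G.row y := G.row_periodic.int_mul a y

theorem col_add_mul (x a : ℤ) : G.col (x + a * G.n) = G.col x := G.col_periodic.int_mul a x

theorem Move.refl (p : ℤ × ℤ) : G.Move p p := Or.inl rfl

theorem Move.row (x y : ℤ) : G.Move (x, y) (x + G.row y, y) := Or.inr (Or.inl rfl)

theorem Move.col (x y : ℤ) : G.Move (x, y) (x, y + G.col x) := Or.inr (Or.inr rfl)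

theorem Cong.refl (p : ℤ × ℤ) : G.Cong p p := ⟨0, 0, by simp⟩

theorem Move.add_period {p p' : ℤ × ℤ} (h : G.Move p p') (a b : ℤ) :
    G.Move (p.1 + a * G.n, p.2 + b * G.n) (p'.1 + a * G.n, p'.2 + b * G.n) := by
  rcases h with rfl | rfl | rfl
  · exact Or.inl rfl
  · refine Or.inr (Or.inl ?_)
    ext
    · simp only [row_add_mul]; ring
    · simp
  · refine Or.inr (Or.inr ?_)
    ext
    · simp
    · simp only [col_add_mul]; ring

theorem Walk.add_period {m : ℕ} {p q : ℤ × ℤ} (h : G.Walk m p q) (a b : ℤ) :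
    G.Walk m (p.1 + a * G.n, p.2 + b * G.n) (q.1 + a * G.n, q.2 + b * G.n) := by
  induction m generalizing p with
  | zero => cases h; rfl
  | succ m ih =>
    obtain ⟨p', h1, h2⟩ := h
    exact ⟨_, h1.add_period a b, ih h2⟩

theorem Walk.snoc {m : ℕ} {p q q' : ℤ × ℤ} (h : G.Walk m p q) (hq : G.Move q q') :
    G.Walk (m + 1) p q' := by
  induction m generalizing p with
  | zero => cases h; exact ⟨q', hq, rfl⟩
  | succ m ih =>
    obtain ⟨p', h1, h2⟩ := h
    exact ⟨p', h1, ih h2⟩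

theorem Walk.trans {m m' : ℕ} {p q q' : ℤ × ℤ} (h : G.Walk m p q) (hq : G.Walk m' q q') :
    G.Walk (m + m') p q' := by
  induction m generalizing p with
  | zero => cases h; simpa using hq
  | succ m ih =>
    obtain ⟨p', h1, h2⟩ := h
    rw [Nat.succ_add]
    exact ⟨p', h1, ih h2⟩

theorem walk_row (x y : ℤ) (m : ℕ) : G.Walk m (x, y) (x + m * G.row y, y) := by
  induction m with
  | zero => simp [Walk]
  | succ m ih =>
    convert ih.snoc (Move.row _ _) using 2
    push_cast; ring

theorem walk_col (x y : ℤ) (m : ℕ) : G.Walk m (x, y) (x, y + m * G.col x) := by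
  induction m with
  | zero => simp [Walk]
  | succ m ih =>
    convert ih.snoc (Move.col _ _) using 2
    push_cast; ring

/-- A multiple of a sign reaches every residue class after finitely many steps. -/
theorem exists_nat_mul_sign (n : ℕ) (hn : 0 < n) (e t : ℤ) (he : e = 1 ∨ e = -1) :
    ∃ (m : ℕ) (a : ℤ), t + a * n = m * e := by
  have hn' : (0 : ℤ) < n := by exact_mod_cast hn
  have h0 := Int.emod_nonneg (e * t) hn'.ne'
  have h1 := Int.emod_add_mul_ediv (e * t) n
  refine ⟨(e * t % n).toNat, -e * (e * t / n), ?_⟩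
  rw [Int.toNat_of_nonneg h0]
  have h2 : e * t % n = e * t - n * (e * t / n) := by linarith
  rw [h2]
  rcases he with rfl | rfl <;> ring

/-- The oriented torus is strongly connected, since its rows and columns are directed cycles. -/
theorem exists_walk (p q : ℤ × ℤ) : ∃ m q', G.Walk m p q' ∧ G.Cong q' q := by
  obtain ⟨x, y⟩ := p
  obtain ⟨u, v⟩ := q
  obtain ⟨m, a, h⟩ := exists_nat_mul_sign G.n G.n_pos (G.row y) (u - x) (G.row_eq y)
  obtain ⟨m', b, h'⟩ := exists_nat_mul_sign G.n G.n_pos (G.col (x + m * G.row y)) (v - y)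
    (G.col_eq _)
  refine ⟨m + m', _, (walk_row x y m).trans (walk_col _ _ m'), -a, -b, ?_⟩
  ext
  · simp only; linarith
  · simp only; linarith

/-! ### Positions from which the robber escapes -/

/-- The moves of a robber who neither stays nor makes a detour. The mark `h` is `η = ±1` if the
last horizontal move was in direction `η` between two columns of the same direction, and `0`
otherwise. A detour is a horizontal move in direction `-h`: it returns to the column that was left
by the last horizontal move, although that column leads to the same vertex directly. -/
def Run (G : OrientedGrid) (r : ℤ × ℤ) (h : ℤ) (r' : ℤ × ℤ) (h' : ℤ) : Prop :=
  (r' = (r.1 + G.row r.2, r.2) ∧ h ≠ -G.row r.2 ∧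
    h' = if G.col (r.1 + G.row r.2) = G.col r.1 then G.row r.2 else 0) ∨
  (r' = (r.1, r.2 + G.col r.1) ∧ h' = h)

theorem Run.fst_near {r r' : ℤ × ℤ} {h h' : ℤ} (H : G.Run r h r' h') :
    r'.1 ≤ r.1 + 1 ∧ r.1 ≤ r'.1 + 1 := by
  rcases H with ⟨rfl, -, -⟩ | ⟨rfl, -⟩
  · rcases G.row_eq r.2 with h | h <;> constructor <;> simp only [h] <;> omega
  · simp

variable {ι : Type*} [DecidableEq ι]

/-- A set `N` of positions with the robber to move (cops `c`, robber `r`, mark `h` of the robber) in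
which he can remain for ever while running, whatever the cops with index in `S` do. The other cops
are committed to a strategy that keeps the position in `N`. -/
structure Evasion (G : OrientedGrid) (S : Finset ι) (N : (ι → ℤ × ℤ) → ℤ × ℤ → ℤ → Prop) :
    Prop where
  ne : ∀ {c r h}, N c r h → ∀ i ∈ S, c i ≠ r
  cong : ∀ {c r h}, N c r h → ∀ c' : ι → ℤ × ℤ, (∀ i ∈ S, G.Cong (c i) (c' i)) →
    ∃ c'', (∀ i ∈ S, c'' i = c' i) ∧ N c'' r h
  step : ∀ {c r h}, N c r h → ∃ r' h', G.Run r h r' h' ∧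
    ∀ c' : ι → ℤ × ℤ, (∀ i ∈ S, G.Move (c i) (c' i)) → ∃ c'', (∀ i ∈ S, c'' i = c' i) ∧ N c'' r' h'

/-- The cops are to move: after any moves of those with index in `S`, the committed cops can be placed
so that the position is in `N`. -/
def CopsTurn (G : OrientedGrid) (S : Finset ι) (N : (ι → ℤ × ℤ) → ℤ × ℤ → ℤ → Prop)
    (c : ι → ℤ × ℤ) (r : ℤ × ℤ) (h : ℤ) : Prop :=
  ∀ c' : ι → ℤ × ℤ, (∀ i ∈ S, G.Move (c i) (c' i)) → ∃ c'', (∀ i ∈ S, c'' i = c' i) ∧ N c'' r h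

/-! ### Two pursuers make the robber run -/

section Chase

variable [Fintype ι] {N : (ι → ℤ × ℤ) → ℤ × ℤ → Prop}

/-- The pursuer `k` has a walk to the robber, or, if the mark is `h = ±1`, to the vertex next to the
robber in the column left by his last horizontal move; the pursuer `q` has a walk to the robber. The
number `m` is the total length of these walks, with one more for the step beside the robber. -/
def Chase (G : OrientedGrid) (N : (ι → ℤ × ℤ) → ℤ × ℤ → Prop) (k q : ι) (m : ℕ)
    (c : ι → ℤ × ℤ) (r : ℤ × ℤ) (h : ℤ) : Prop :=
  N c r ∧ (h = 0 ∨ h = 1 ∨ h = -1) ∧ G.col (r.1 - h) = G.col r.1 ∧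
    ∃ a b, G.Walk a (c k) (r.1 - h, r.2) ∧ G.Walk b (c q) r ∧ a + h.natAbs + b = m

/-- The answer of the pursuer `k`: no move of the robber lengthens the pursuit, and a detour
shortens it. -/
theorem exists_pursuit_move {x y h : ℤ} {a : ℕ} {p r' : ℤ × ℤ} (hm : G.Move (x, y) r')
    (hr : r' ≠ (x, y)) (hh : h = 0 ∨ h = 1 ∨ h = -1) (hcol : G.col (x - h) = G.col x)
    (hw : G.Walk a p (x - h, y)) (hp : p ≠ (x, y)) :
    ∃ p' h' a', G.Move p p' ∧ (h' = 0 ∨ h' = 1 ∨ h' = -1) ∧ G.col (r'.1 - h') = G.col r'.1 ∧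
      G.Walk a' p' (r'.1 - h', r'.2) ∧ (a' + h'.natAbs < a + h.natAbs ∨
        (a' + h'.natAbs = a + h.natAbs ∧ G.Run (x, y) h r' h')) := by
  have hrow := G.row_eq y
  rcases hm with rfl | rfl | rfl
  · exact absurd rfl hr
  · set e := G.row y with he
    have hmv : ∀ z, G.Move (z, y) (z + e, y) := fun z => Move.row z y
    by_cases hb : h = -e
    · -- a detour leads the robber to the target of the pursuer
      refine ⟨p, 0, a, Move.refl p, Or.inl rfl, by simp, ?_, Or.inl ?_⟩
      · subst hb; simpa using hw
      · rcases hrow with h1 | h1 <;> rw [hb, h1] <;> simp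
    have hhe : h = 0 ∨ h = e := by
      rcases hrow with h1 | h1 <;> rw [h1] at hb ⊢ <;> omega
    have hne : e.natAbs = 1 := by rcases hrow with h1 | h1 <;> rw [h1] <;> rfl
    by_cases hs : G.col (x + e) = G.col x
    · have hrun : G.Run (x, y) h (x + e, y) e := Or.inl ⟨rfl, hb, by simp [← he, hs]⟩
      rcases hhe with h0 | h0
      · subst h0
        cases a with
        | zero => simp only [Walk, sub_zero] at hw; exact absurd hw hp
        | succ a =>
          obtain ⟨p', h1, h2⟩ := hw
          exact ⟨p', e, a, h1, Or.inr hrow, by simp [hs], by simpa using h2,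
            Or.inr ⟨by simp [hne], hrun⟩⟩
      · obtain ⟨p', h1, h2⟩ := hw.snoc (hmv _)
        refine ⟨p', e, a, h1, Or.inr hrow, by simp [hs], ?_, Or.inr ⟨by rw [h0], hrun⟩⟩
        rw [h0] at h2; simpa using h2
    · have hrun : G.Run (x, y) h (x + e, y) 0 := Or.inl ⟨rfl, hb, by simp [← he, hs]⟩
      rcases hhe with h0 | h0
      · obtain ⟨p', h1, h2⟩ := hw.snoc (hmv _)
        refine ⟨p', 0, a, h1, Or.inl rfl, by simp, ?_, Or.inr ⟨by rw [h0], hrun⟩⟩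
        rw [h0] at h2; simpa using h2
      · obtain ⟨p', h1, h2⟩ := (hw.snoc (hmv _)).snoc (hmv _)
        refine ⟨p', 0, a + 1, h1, Or.inl rfl, by simp, ?_, Or.inr ⟨by rw [h0]; simp [hne], hrun⟩⟩
        rw [h0] at h2; simpa using h2
  · obtain ⟨p', h1, h2⟩ := hw.snoc (Move.col _ _)
    refine ⟨p', h, a, h1, hh, hcol, ?_, Or.inr ⟨rfl, Or.inr ⟨rfl, rfl⟩⟩⟩
    rw [hcol] at h2; exact h2

/-- If the total length of the pursuit is as small as possible among all positions in which the
robber escapes, then he neither stays nor makes a detour. -/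
theorem exists_evasion_of_pursuers {k q : ι} (hkq : k ≠ q) (hne : ∀ {c r}, N c r → ∀ i, c i ≠ r)
    (hcong : ∀ {c r}, N c r → ∀ c' : ι → ℤ × ℤ, (∀ i, G.Cong (c i) (c' i)) → N c' r)
    (hstep : ∀ {c r}, N c r → ∃ r', G.Move r r' ∧
      ∀ c' : ι → ℤ × ℤ, (∀ i, G.Move (c i) (c' i)) → N c' r')
    {c : ι → ℤ × ℤ} {r : ℤ × ℤ} (hN : N c r) :
    ∃ N' : (ι → ℤ × ℤ) → ℤ × ℤ → ℤ → Prop,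
      G.Evasion ((Finset.univ.erase k).erase q) N' ∧ ∃ c r h, N' c r h := by
  classical
  have hex : ∃ m, ∃ c r h, Chase G N k q m c r h := by
    have aux : ∀ p, ∃ p' m, G.Cong p p' ∧ G.Walk m p' r := by
      intro p
      obtain ⟨m, r', h1, a, b, h2⟩ := exists_walk (G := G) p r
      exact ⟨_, m, ⟨a, b, rfl⟩, h2 ▸ h1.add_period a b⟩
    obtain ⟨p, a, h1, h2⟩ := aux (c k)
    obtain ⟨p', b, h3, h4⟩ := aux (c q)
    refine ⟨_, Function.update (Function.update c k p) q p', r, 0, hcong hN _ ?_, Or.inl rfl,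
      by simp, a, b, ?_, ?_, rfl⟩
    · intro i
      by_cases hq : i = q
      · subst hq; simpa using h3
      by_cases hk : i = k
      · subst hk; simpa [hq] using h1
      · simpa [hq, hk] using Cong.refl _
    · simpa [hkq] using h2
    · simpa using h4
  obtain ⟨c0, r0, h0, H0⟩ := Nat.find_spec hex
  have hmin : ∀ m' < Nat.find hex, ∀ c r h, ¬ Chase G N k q m' c r h := fun m' hm' c r h H =>
    Nat.find_min hex hm' ⟨c, r, h, H⟩
  set m := Nat.find hex
  refine ⟨Chase G N k q m, ⟨fun H i _ => hne H.1 i, ?_, ?_⟩, c0, r0, h0, H0⟩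
  · rintro c r h ⟨H, H1, H2, a, b, H3, H4, H5⟩ c' hc'
    refine ⟨fun i => if i ∈ (Finset.univ.erase k).erase q then c' i else c i,
      fun i hi => if_pos hi, hcong H _ fun i => ?_, H1, H2, a, b, ?_, ?_, H5⟩
    · split_ifs with hi
      · exact hc' i hi
      · exact Cong.refl _
    · simpa using H3
    · simpa using H4
  · rintro c ⟨x, y⟩ h ⟨H, H1, H2, a, b, H3, H4, H5⟩
    obtain ⟨r', hr', hrep⟩ := hstep H
    have hk := hne H k
    have hq := hne H q
    -- the replies of the two pursuers are inserted into the moves of the others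
    have key : ∀ p p', G.Move (c k) p → G.Move (c q) p' → ∀ c' : ι → ℤ × ℤ,
        (∀ i ∈ (Finset.univ.erase k).erase q, G.Move (c i) (c' i)) →
        N (Function.update (Function.update c' k p) q p') r' := by
      intro p p' h1 h2 c' hc'
      refine hrep _ fun i => ?_
      by_cases hiq : i = q
      · subst hiq; simpa using h2
      by_cases hik : i = k
      · subst hik; simpa [hiq] using h1
      · simpa [hiq, hik] using hc' i (by simp [hiq, hik])
    by_cases hst : r' = (x, y)
    · exfalso
      cases b with
      | zero => exact hq H4
      | succ b =>
        obtain ⟨p', h1, h2⟩ := H4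
        refine hmin (a + h.natAbs + b) (by omega) _ (x, y) h ⟨hst ▸ key (c k) p' (Move.refl _) h1 c
          fun i _ => Move.refl _, H1, H2, a, b, ?_, ?_, rfl⟩
        · simpa [hkq] using H3
        · simpa using h2
    · obtain ⟨p, h', a', h1, h2, h3, h4, h5⟩ := exists_pursuit_move hr' hst H1 H2 H3 hk
      obtain ⟨p', h6, h7⟩ := H4.snoc hr'
      have hch : ∀ c' : ι → ℤ × ℤ, (∀ i ∈ (Finset.univ.erase k).erase q, G.Move (c i) (c' i)) →
          Chase G N k q (a' + h'.natAbs + b) (Function.update (Function.update c' k p) q p')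
            r' h' := by
        intro c' hc'
        refine ⟨key p p' h1 h6 c' hc', h2, h3, a', b, ?_, ?_, rfl⟩
        · simpa [hkq] using h4
        · simpa using h7
      rcases h5 with h5 | ⟨h5, hrun⟩
      · exact absurd (hch c fun i _ => Move.refl _) (hmin _ (by omega) _ _ _)
      · refine ⟨r', h', hrun, fun c' hc' =>
          ⟨Function.update (Function.update c' k p) q p', fun i hi => ?_, ?_⟩⟩
        · simp only [Finset.mem_erase] at hi
          simp [hi.1, hi.2.1]
        · have := hch c' hc'
          rwa [h5, H5] at this

end Chase

/-! ### Committing cops and moving cops -/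

namespace Evasion

variable {S : Finset ι} {N : (ι → ℤ × ℤ) → ℤ × ℤ → ℤ → Prop}

/-- Cop `j` can be committed to any relation `T` to the robber that it can maintain. -/
theorem restrict (hE : G.Evasion S N) {j : ι} (hj : j ∈ S) (T : ℤ × ℤ → ℤ × ℤ → ℤ → Prop)
    (hT : ∀ {c r h r' h'}, N c r h → T (c j) r h → G.Run r h r' h' →
      ∃ b, G.Move (c j) b ∧ (b = r' ∨ T b r' h')) :
    G.Evasion (S.erase j) fun c r h => N c r h ∧ T (c j) r h where
  ne H i hi := hE.ne H.1 i (Finset.mem_of_mem_erase hi)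
  cong {c r h} H c' hc' := by
    obtain ⟨c'', h1, h2⟩ := hE.cong H.1 (Function.update c' j (c j)) fun i hi => by
      by_cases hij : i = j
      · subst hij; simpa using Cong.refl _
      · simpa [hij] using hc' i (Finset.mem_erase.2 ⟨hij, hi⟩)
    refine ⟨c'', fun i hi => ?_, h2, ?_⟩
    · rw [h1 i (Finset.mem_of_mem_erase hi), Function.update_of_ne (Finset.ne_of_mem_erase hi)]
    · rw [h1 j hj, Function.update_self]; exact H.2
  step {c r h} H := by
    obtain ⟨r', h', hrun, hrep⟩ := hE.step H.1
    obtain ⟨b, hb, hb'⟩ := hT H.1 H.2 hrun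
    refine ⟨r', h', hrun, fun c' hc' => ?_⟩
    obtain ⟨c'', h1, h2⟩ := hrep (Function.update c' j b) fun i hi => by
      by_cases hij : i = j
      · subst hij; simpa using hb
      · simpa [hij] using hc' i (Finset.mem_erase.2 ⟨hij, hi⟩)
    have h3 : c'' j = b := by rw [h1 j hj, Function.update_self]
    refine ⟨c'', fun i hi => ?_, h2, ?_⟩
    · rw [h1 i (Finset.mem_of_mem_erase hi), Function.update_of_ne (Finset.ne_of_mem_erase hi)]
    · rw [h3]
      exact hb'.resolve_left fun h4 => hE.ne h2 j hj (h3.trans h4)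

/-- Cop `d` walks to `v` while the other cops stand still, unless the robber leaves `I` before. -/
theorem exists_walked (hE : G.Evasion S N) {d : ι} (I : ℤ × ℤ → Prop) {v : ℤ × ℤ} {m : ℕ}
    {c : ι → ℤ × ℤ} {r : ℤ × ℤ} {h : ℤ} (H : N c r h) (hI : I r) (hw : G.Walk m (c d) v) :
    (∃ c' r₀ h₀ r' h', (∀ i ∈ S, i ≠ d → c' i = c i) ∧ I r₀ ∧ G.Run r₀ h₀ r' h' ∧ ¬ I r' ∧
      G.CopsTurn S N c' r' h') ∨
    ∃ c' r' h', (∀ i ∈ S, i ≠ d → c' i = c i) ∧ (d ∈ S → c' d = v) ∧ I r' ∧ N c' r' h' := by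
  induction m generalizing c r h with
  | zero => exact Or.inr ⟨c, r, h, fun _ _ _ => rfl, fun _ => hw, hI, H⟩
  | succ m ih =>
    obtain ⟨p, hp, hw⟩ := hw
    obtain ⟨r', h', hrun, hrep⟩ := hE.step H
    by_cases hI' : I r'
    · by_cases hd : d ∈ S
      · obtain ⟨c'', h1, h2⟩ := hrep (Function.update c d p) fun i _ => by
          by_cases hid : i = d
          · subst hid; simpa using hp
          · simpa [hid] using Move.refl _
        have h3 : ∀ i ∈ S, i ≠ d → c'' i = c i := fun i hi hid => by rw [h1 i hi]; simp [hid]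
        have h4 : c'' d = p := by rw [h1 d hd]; simp
        rcases ih h2 hI' (h4 ▸ hw) with ⟨c', r₁, h₁, r₂, h₂, g1, g2⟩ | ⟨c', r₂, h₂, g1, g2⟩
        · exact Or.inl ⟨c', r₁, h₁, r₂, h₂, fun i hi hid => (g1 i hi hid).trans (h3 i hi hid), g2⟩
        · exact Or.inr ⟨c', r₂, h₂, fun i hi hid => (g1 i hi hid).trans (h3 i hi hid), g2⟩
      · exact Or.inr ⟨c, r, h, fun _ _ _ => rfl, fun hd' => absurd hd' hd, hI, H⟩
    · exact Or.inl ⟨c, r, h, r', h', fun _ _ _ => rfl, hI, hrun, hI', hrep⟩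

/-- Cop `d` goes to a given vertex of the torus while the other cops stand still, unless the robber
leaves `I` before. -/
theorem exists_moved (hE : G.Evasion S N) {d : ι} (hd : d ∈ S) (I : ℤ × ℤ → Prop) (v : ℤ × ℤ)
    {c : ι → ℤ × ℤ} {r : ℤ × ℤ} {h : ℤ} (H : N c r h) (hI : I r) :
    (∃ c' r₀ h₀ r' h', (∀ i ∈ S, i ≠ d → c' i = c i) ∧ I r₀ ∧ G.Run r₀ h₀ r' h' ∧ ¬ I r' ∧
      G.CopsTurn S N c' r' h') ∨
    ∃ c' r' h', (∀ i ∈ S, i ≠ d → c' i = c i) ∧ c' d = v ∧ I r' ∧ N c' r' h' := by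
  obtain ⟨m, v', hw, hv⟩ := exists_walk (G := G) (c d) v
  refine (hE.exists_walked I H hI hw).imp_right ?_
  rintro ⟨c', r', h', h1, h2, h3, h4⟩
  obtain ⟨c'', h5, h6⟩ := hE.cong h4 (Function.update c' d v) fun i _ => by
    by_cases hid : i = d
    · subst hid; simpa [h2 hd] using hv
    · simpa [hid] using Cong.refl _
  refine ⟨c'', r', h', fun i hi hid => ?_, ?_, h3, h6⟩
  · rw [h5 i hi, Function.update_of_ne hid, h1 i hi hid]
  · rw [h5 d hd, Function.update_self]

/-- Let a vertex `(u, pos u)` be marked in each column `u`. Three cops can achieve that the robber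
enters a column in which a cop is waiting at the marked vertex: two waiting cops confine the robber
to the columns between them, and the third cop cuts this range into smaller pieces. -/
theorem exists_aligned_of_confined (hE : G.Evasion S N) (pos : ℤ → ℤ) (g : ℕ) :
    ∀ {a b d : ι}, a ∈ S → b ∈ S → d ∈ S → a ≠ b → a ≠ d → b ≠ d →
    ∀ {c r h u₁ u₂}, N c r h → c a = (u₁, pos u₁) → c b = (u₂, pos u₂) → u₁ < r.1 → r.1 < u₂ →
      u₂ - u₁ ≤ g →
      ∃ c' r' h', ∃ l ∈ S, c' l = (r'.1, pos r'.1) ∧ G.CopsTurn S N c' r' h' := by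
  induction g with
  | zero => intros; omega
  | succ g ih =>
    intro a b d ha hb hd hab had hbd c r h u₁ u₂ H ha1 hb1 h1 h2 hg
    have hexit : ∀ c' : ι → ℤ × ℤ, c' a = c a → c' b = c b →
        ∀ r₀ h₀ r' h', (u₁ < r₀.1 ∧ r₀.1 < u₂) → G.Run r₀ h₀ r' h' → ¬ (u₁ < r'.1 ∧ r'.1 < u₂) →
        G.CopsTurn S N c' r' h' →
        ∃ c' r' h', ∃ l ∈ S, c' l = (r'.1, pos r'.1) ∧ G.CopsTurn S N c' r' h' := by
      intro c' ha2 hb2 r₀ h₀ r' h' hI hrun hI' hturn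
      have := hrun.fst_near
      have : r'.1 = u₁ ∨ r'.1 = u₂ := by omega
      rcases this with hu | hu
      · exact ⟨c', r', h', a, ha, by rw [ha2, ha1, hu], hturn⟩
      · exact ⟨c', r', h', b, hb, by rw [hb2, hb1, hu], hturn⟩
    rcases hE.exists_moved hd (fun r => u₁ < r.1 ∧ r.1 < u₂) (r.1, pos r.1) H ⟨h1, h2⟩ with
      ⟨c', r₀, h₀, r', h', g1, g2, g3, g4, g5⟩ | ⟨c', r₀, h₀, g1, g2, g3, g4⟩
    · exact hexit c' (g1 a ha had) (g1 b hb hbd) r₀ h₀ r' h' g2 g3 g4 g5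
    · obtain ⟨r', h', hrun, hrep⟩ := hE.step g4
      have ha2 := (g1 a ha had).trans ha1
      have hb2 := (g1 b hb hbd).trans hb1
      by_cases hI' : u₁ < r'.1 ∧ r'.1 < u₂
      · obtain ⟨c'', e1, e2⟩ := hrep c' fun i _ => Move.refl _
        rcases lt_trichotomy r'.1 r.1 with hlt | heq | hgt
        · exact ih ha hd hb had hab (Ne.symm hbd) e2 ((e1 a ha).trans ha2) ((e1 d hd).trans g2)
            hI'.1 hlt (by omega)
        · exact ⟨c', r', h', d, hd, by rw [g2, heq], hrep⟩
        · exact ih hd hb ha (Ne.symm hbd) (Ne.symm had) (Ne.symm hab) e2 ((e1 d hd).trans g2)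
            ((e1 b hb).trans hb2) hgt hI'.2 (by omega)
      · exact hexit c' (g1 a ha had) (g1 b hb hbd) r₀ h₀ r' h' g3 hrun hI' hrep

theorem exists_aligned (hE : G.Evasion S N) (hS : 3 ≤ S.card) {pos : ℤ → ℤ}
    (hpos : Function.Periodic pos (G.n : ℤ)) {c : ι → ℤ × ℤ} {r : ℤ × ℤ} {h : ℤ} (H : N c r h) :
    ∃ c' r' h', ∃ l ∈ S, c' l = (r'.1, pos r'.1) ∧ G.CopsTurn S N c' r' h' := by
  obtain ⟨a, b, d, ha, hb, hd, hab, had, hbd⟩ := Finset.two_lt_card_iff.1 hS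
  obtain ⟨c₁, r₁, h₁, -, f2, -, f3⟩ :=
    (hE.exists_moved ha (fun _ => True) (0, pos 0) H trivial).resolve_left
      (fun ⟨_, _, _, _, _, _, _, _, hn, _⟩ => hn trivial)
  obtain ⟨c₂, r₂, h₂, g1, g2, -, g3⟩ :=
    (hE.exists_moved hb (fun _ => True) (0, pos 0) f3 trivial).resolve_left
      (fun ⟨_, _, _, _, _, _, _, _, hn, _⟩ => hn trivial)
  -- lifts of the two waiting cops on both sides of the robber
  have hn : (1 : ℤ) ≤ G.n := by exact_mod_cast G.n_pos
  set t : ℤ := |r₂.1| + 1 with ht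
  have ht1 : |r₂.1| < t * G.n := by nlinarith [abs_nonneg r₂.1]
  have hper : ∀ s : ℤ, pos (s * G.n) = pos 0 := fun s => by
    have := hpos.int_mul s 0; rwa [zero_add] at this
  obtain ⟨c₃, e1, e2⟩ := hE.cong g3 (Function.update (Function.update c₂ a
      (-t * G.n, pos (-t * G.n))) b (t * G.n, pos (t * G.n))) fun i _ => by
    by_cases hib : i = b
    · subst hib; rw [Function.update_self, g2, hper]; exact ⟨t, 0, by simp⟩
    by_cases hia : i = a
    · subst hia
      rw [Function.update_of_ne hib, Function.update_self, g1 i ha hab, f2, hper]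
      exact ⟨-t, 0, by simp⟩
    · simpa [hib, hia] using Cong.refl _
  obtain ⟨hl, hr⟩ := abs_lt.1 ht1
  exact hE.exists_aligned_of_confined pos (t * G.n - -t * G.n).toNat ha hb hd hab had hbd e2
    (by rw [e1 a ha]; simp [hab]) (by rw [e1 b hb]; simp) (by linarith) hr (Int.self_le_toNat _)

/-! ### Squeezing the robber between two guarded lines -/

/-- Suppose that a cop in the relation `Gd 1 Y` to the robber keeps him in the rows up to `Y`, and a
cop in the relation `Gd (-1) Y` keeps him in the rows from `Y` on. If guards of both kinds can be
obtained, and inside any range so guarded a tighter guard can be obtained, by aligning a cop with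
the robber, then the robber cannot escape: the range would shrink for ever. -/
theorem false_of_guards (hE : G.Evasion S N) (hS : 5 ≤ S.card)
    (Gd : ℤ → ℤ → ℤ × ℤ → ℤ × ℤ → ℤ → Prop)
    (hkeep : ∀ {σ}, σ = 1 ∨ σ = -1 → ∀ {Y c b r h r' h'}, N c r h → Gd σ Y b r h →
      G.Run r h r' h' → ∃ b', G.Move b b' ∧ (b' = r' ∨ Gd σ Y b' r' h'))
    (hside : ∀ {σ Y b r h}, Gd σ Y b r h → 0 ≤ σ * (Y - r.2))
    (hinit : ∃ pos : ℤ → ℤ, Function.Periodic pos (G.n : ℤ) ∧ ∀ {σ}, σ = 1 ∨ σ = -1 → ∀ r h,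
      ∃ j Y, Gd σ Y (r.1, pos r.1 + j * G.n) r h)
    (hnew : ∀ {c r h Y₁ Y₂}, ∀ i ∈ S, ∀ j ∈ S, i ≠ j → N c r h → Gd 1 Y₁ (c i) r h →
      Gd (-1) Y₂ (c j) r h → ∃ pos : ℤ → ℤ, Function.Periodic pos (G.n : ℤ) ∧
        ∀ r h, Y₂ ≤ r.2 → r.2 ≤ Y₁ → (∀ b, G.Move (r.1, pos r.1) b → b ≠ r) →
          (∃ Y < Y₁, Gd 1 Y (r.1, pos r.1) r h) ∨ ∃ Y > Y₂, Gd (-1) Y (r.1, pos r.1) r h)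
    (c : ι → ℤ × ℤ) (r : ℤ × ℤ) (h : ℤ) : ¬ N c r h := by
  intro H
  have hone : (1 : ℤ) = 1 ∨ (1 : ℤ) = -1 := Or.inl rfl
  have hneg : (-1 : ℤ) = 1 ∨ (-1 : ℤ) = -1 := Or.inr rfl
  -- a position with a free cop on a given aligned vertex, up to congruence
  have hplace : ∀ {S' : Finset ι} {N' : (ι → ℤ × ℤ) → ℤ × ℤ → ℤ → Prop} {pos : ℤ → ℤ} {c r h}
      {l : ι}, G.Evasion S' N' → l ∈ S' → c l = (r.1, pos r.1) → G.CopsTurn S' N' c r h →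
      ∀ j : ℤ, ∃ c', c' l = (r.1, pos r.1 + j * G.n) ∧ N' c' r h := by
    intro S' N' pos c r h l hE' hl hcl hturn j
    obtain ⟨c₁, e1, e2⟩ := hturn c fun i _ => Move.refl _
    obtain ⟨c₂, e3, e4⟩ := hE'.cong e2 (Function.update c₁ l (r.1, pos r.1 + j * G.n)) fun i _ => by
      by_cases hil : i = l
      · subst hil; rw [Function.update_self, e1 i hl, hcl]; exact ⟨0, j, by simp⟩
      · simpa [hil] using Cong.refl _
    exact ⟨c₂, by rw [e3 l hl, Function.update_self], e4⟩
  have hcard : ∀ i ∈ S, 4 ≤ (S.erase i).card := fun i hi => by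
    rw [Finset.card_erase_of_mem hi]; omega
  have hcard2 : ∀ i ∈ S, ∀ j ∈ S.erase i, 3 ≤ ((S.erase i).erase j).card := fun i hi j hj => by
    rw [Finset.card_erase_of_mem hj]; have := hcard i hi; omega
  have hshrink : ∀ g : ℕ, ∀ {c r h Y₁ Y₂}, ∀ i ∈ S, ∀ j ∈ S, i ≠ j → N c r h →
      Gd 1 Y₁ (c i) r h → Gd (-1) Y₂ (c j) r h → Y₁ - Y₂ ≤ g → False := by
    intro g
    induction g using Nat.strong_induction_on with
    | _ g ih =>
      intro c r h Y₁ Y₂ i hi j hj hij H h1 h2 hg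
      obtain ⟨pos, hpos, hnew⟩ := hnew i hi j hj hij H h1 h2
      have hj' : j ∈ S.erase i := Finset.mem_erase.2 ⟨hij.symm, hj⟩
      have hE2 := (hE.restrict hi (Gd 1 Y₁) (hkeep hone)).restrict hj' (Gd (-1) Y₂)
        fun H => hkeep hneg H.1
      obtain ⟨c₁, r₁, t₁, l, hl, hcl, hturn⟩ :=
        hE2.exists_aligned (hcard2 i hi j hj') hpos ⟨⟨H, h1⟩, h2⟩
      obtain ⟨c₂, e1, ⟨e2, e3⟩, e4⟩ := hplace hE2 hl hcl hturn 0
      have s1 := hside e3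
      have s2 := hside e4
      have hlS : l ∈ S := Finset.mem_of_mem_erase (Finset.mem_of_mem_erase hl)
      have hlj := Finset.ne_of_mem_erase hl
      have hli := Finset.ne_of_mem_erase (Finset.mem_of_mem_erase hl)
      rw [zero_mul, add_zero] at e1
      have hfree : ∀ b, G.Move (r₁.1, pos r₁.1) b → b ≠ r₁ := by
        intro b hb hbr
        obtain ⟨c₃, f1, f2⟩ := hturn (Function.update c₁ l b) fun i _ => by
          by_cases hil : i = l
          · subst hil; simpa [hcl] using hb
          · simpa [hil] using Move.refl _
        exact hE2.ne f2 l hl (by rw [f1 l hl, Function.update_self, hbr])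
      rcases hnew r₁ t₁ (by linarith) (by linarith) hfree with ⟨Y, hY, hG⟩ | ⟨Y, hY, hG⟩
      · have := hside hG
        exact ih (Y - Y₂).toNat (by omega) l hlS j hj hlj e2 (e1 ▸ hG) e4 (Int.self_le_toNat _)
      · have := hside hG
        exact ih (Y₁ - Y).toNat (by omega) i hi l hlS hli.symm e2 e3 (e1 ▸ hG)
          (Int.self_le_toNat _)
  obtain ⟨pos, hpos, hinit⟩ := hinit
  obtain ⟨c₁, r₁, t₁, i, hi, hci, hturn⟩ := hE.exists_aligned (by omega) hpos H
  obtain ⟨j, Y₁, hG⟩ := hinit hone r₁ t₁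
  obtain ⟨c₂, e1, e2⟩ := hplace hE hi hci hturn j
  have hE1 := hE.restrict hi (Gd 1 Y₁) (hkeep hone)
  obtain ⟨c₃, r₃, t₃, l, hl, hcl, hturn'⟩ := hE1.exists_aligned
    (by have := hcard i hi; omega) hpos ⟨e2, e1 ▸ hG⟩
  obtain ⟨j', Y₂, hG'⟩ := hinit hneg r₃ t₃
  obtain ⟨c₄, e3, e4, e5⟩ := hplace hE1 hl hcl hturn' j'
  exact hshrink (Y₁ - Y₂).toNat i hi l (Finset.mem_of_mem_erase hl)
    (Finset.ne_of_mem_erase hl).symm e4 e5 (e3 ▸ hG') (Int.self_le_toNat _)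

end Evasion
/-! ### Guards -/

/-- The cop `b` is in the column of the robber `r` and in row `Y + σ`, which has direction `η`, and
the robber is on the other side of this row, in row `Y` or beyond. -/
def RowGuard (G : OrientedGrid) (η σ Y : ℤ) (b r : ℤ × ℤ) : Prop :=
  b = (r.1, Y + σ) ∧ G.row (Y + σ) = η ∧ 0 ≤ σ * (Y - r.2)

/-- As long as the robber only visits rows of direction `η`, the guard can stay in his column. -/
theorem RowGuard.keep {η σ Y h h' : ℤ} {b r r' : ℤ × ℤ} (hσ : σ = 1 ∨ σ = -1)
    (hg : G.RowGuard η σ Y b r) (hη : G.row r.2 = η) (hrun : G.Run r h r' h') :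
    ∃ b', G.Move b b' ∧ (b' = r' ∨ G.RowGuard η σ Y b' r') := by
  obtain ⟨x, y⟩ := r
  obtain ⟨rfl, hY, hs⟩ := hg
  rcases hrun with ⟨rfl, -⟩ | ⟨rfl, -⟩
  · refine ⟨(x + G.row (Y + σ), Y + σ), Move.row _ _, Or.inr ⟨?_, hY, hs⟩⟩
    simp only at hη ⊢
    rw [hY, hη]
  · refine ⟨(x, Y + σ), Move.refl _, ?_⟩
    simp only [RowGuard, hY, Prod.mk.injEq, true_and] at hs ⊢
    rcases hσ with rfl | rfl <;> rcases G.col_eq x with hc | hc <;> rw [hc] <;> omega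

/-- A robber who only visits rows of direction `η` is caught by five more cops. -/
theorem Evasion.not_of_row {S : Finset ι} {N : (ι → ℤ × ℤ) → ℤ × ℤ → ℤ → Prop}
    (hE : G.Evasion S N) (hS : 5 ≤ S.card) {η : ℤ}
    (hη : ∀ {c r h}, N c r h → G.row r.2 = η) (c : ι → ℤ × ℤ) (r : ℤ × ℤ) (h : ℤ) :
    ¬ N c r h := by
  intro H
  refine hE.false_of_guards hS (fun σ Y b r _ => G.RowGuard η σ Y b r)
    (@fun _ hσ _ _ _ _ _ _ _ H hg hrun => hg.keep hσ (hη H) hrun) (fun hg => hg.2.2)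
    ⟨fun _ => r.2, fun _ => rfl, ?_⟩ ?_ c r h H
  · intro σ hσ r₁ _
    have hn : (1 : ℤ) ≤ G.n := by exact_mod_cast G.n_pos
    have hab := abs_nonneg (r.2 - r₁.2)
    have hle := le_abs_self (r.2 - r₁.2)
    have hge := neg_abs_le (r.2 - r₁.2)
    refine ⟨σ * (|r.2 - r₁.2| + 1), r.2 + σ * (|r.2 - r₁.2| + 1) * G.n - σ, ?_, ?_, ?_⟩
    · simp
    · rw [sub_add_cancel, row_add_mul]; exact hη H
    · rcases hσ with rfl | rfl <;> nlinarith
  · intro c r h Y₁ Y₂ i _ j _ _ H h1 h2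
    have s1 := h1.2.2
    have s2 := h2.2.2
    refine ⟨fun _ => r.2, fun _ => rfl, fun r₁ _ g1 g2 hfree => ?_⟩
    have hne : r₁.2 ≠ r.2 := fun he => hfree _ (Move.refl _) (by ext <;> simp [he])
    rcases lt_or_gt_of_ne hne with hlt | hgt
    · exact Or.inl ⟨r.2 - 1, by omega, by simp, by simpa using hη H, by omega⟩
    · exact Or.inr ⟨r.2 + 1, by omega, by simp, by simpa using hη H, by omega⟩

/-- Rows `Y` and `Y + σ` have opposite directions, and the robber `r = (x, y)` is on the side of the
first one, in row `Y` or beyond. The cop `b` is in one of these two rows, and in the column of the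
robber or one step behind him in the direction of its row. In the first case this column allows him
to change to the other row. In the second case a robber who turns back either crosses a column in
which the cop can change to the other row, or makes a detour, as the condition on the mark `h` says.
The robber is in row `Y` itself only in a position in which he has nowhere to go. -/
def RoadGuard (G : OrientedGrid) (σ Y : ℤ) (b r : ℤ × ℤ) (h : ℤ) : Prop :=
  G.row (Y + σ) = -G.row Y ∧
    ((b = (r.1 - G.row Y, Y) ∧ (G.row r.2 = G.row Y ∨ G.col r.1 = -σ) ∧
        (G.col (r.1 - G.row Y) = G.col r.1 → h = G.row Y) ∧ 0 < σ * (Y - r.2)) ∨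
      (b = (r.1, Y) ∧ G.col r.1 = σ ∧ 0 < σ * (Y - r.2)) ∨
      (b = (r.1, Y + σ) ∧ G.col r.1 = -σ ∧ 0 < σ * (Y - r.2)) ∨
      (b = (r.1 + G.row Y, Y + σ) ∧ (G.row r.2 = -G.row Y ∨ G.col r.1 = σ) ∧
        (G.col (r.1 + G.row Y) = G.col r.1 → h = -G.row Y) ∧ 0 ≤ σ * (Y - r.2) ∧
        (r.2 = Y → G.col r.1 = σ)))

theorem RoadGuard.side {σ Y h : ℤ} {b r : ℤ × ℤ} (hg : G.RoadGuard σ Y b r h) :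
    0 ≤ σ * (Y - r.2) := by
  rcases hg.2 with hg | hg | hg | hg
  · exact hg.2.2.2.le
  · exact hg.2.2.le
  · exact hg.2.2.le
  · exact hg.2.2.2.1

theorem RoadGuard.keep {σ Y h h' : ℤ} {b r r' : ℤ × ℤ} (hσ : σ = 1 ∨ σ = -1)
    (hg : G.RoadGuard σ Y b r h) (hrun : G.Run r h r' h') :
    ∃ b', G.Move b b' ∧ (b' = r' ∨ G.RoadGuard σ Y b' r' h') := by
  obtain ⟨x, y⟩ := r
  obtain ⟨hY, hg⟩ := hg
  have hrY := G.row_eq Y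
  have hry := G.row_eq y
  simp only at hg
  rcases hg with ⟨rfl, g1, g2, g3⟩ | ⟨rfl, g1, g2⟩ | ⟨rfl, g1, g2⟩ | ⟨rfl, g1, g2, g3, g4⟩
  · have hc := G.col_eq (x - G.row Y)
    have hx := G.col_eq x
    rcases hrun with ⟨rfl, r1, r2⟩ | ⟨rfl, rfl⟩
    · by_cases he : G.row y = G.row Y
      · refine ⟨(x, Y), ?_, Or.inr ⟨hY, Or.inl ⟨?_, Or.inl he, ?_, g3⟩⟩⟩
        · have := Move.row (G := G) (x - G.row Y) Y
          simpa using this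
        · simp [he]
        · simp only [he, add_sub_cancel_right] at r2 ⊢
          intro h1; rw [r2, if_pos h1.symm]
      · have he' : G.row y = -G.row Y := by omega
        refine ⟨(x - G.row Y, Y), Move.refl _, Or.inr ⟨hY, Or.inr (Or.inl ⟨?_, ?_, g3⟩)⟩⟩
        · simp [he', sub_eq_add_neg]
        · simp only [he'] at r1 ⊢
          rw [← sub_eq_add_neg]
          have g1' := g1.resolve_left he
          have : G.col (x - G.row Y) ≠ G.col x := fun h1 => r1 (by rw [g2 h1]; ring)
          omega
    · by_cases he : G.col x = σ
      · refine ⟨(x, Y), ?_, ?_⟩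
        · have := Move.row (G := G) (x - G.row Y) Y
          simpa using this
        · by_cases hy : y + G.col x = Y
          · left; simp [hy]
          · refine Or.inr ⟨hY, Or.inr (Or.inl ⟨rfl, he, ?_⟩)⟩
            simp only [he] at hy ⊢
            rcases hσ with rfl | rfl <;> omega
      · have he' : G.col x = -σ := by omega
        refine ⟨_, Move.refl _, Or.inr ⟨hY, Or.inl ⟨rfl, Or.inr he', g2, ?_⟩⟩⟩
        simp only [he']
        rcases hσ with rfl | rfl <;> omega
  · rcases hrun with ⟨rfl, r1, r2⟩ | ⟨rfl, rfl⟩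
    · by_cases he : G.row y = G.row Y
      · refine ⟨(x, Y), Move.refl _, Or.inr ⟨hY, Or.inl ⟨?_, Or.inl he, ?_, g2⟩⟩⟩
        · simp [he]
        · simp only [he, add_sub_cancel_right] at r2 ⊢
          intro h1; rw [r2, if_pos h1.symm]
      · have he' : G.row y = -G.row Y := by omega
        refine ⟨(x, Y + σ), ?_, Or.inr ⟨hY, Or.inr (Or.inr (Or.inr
          ⟨?_, Or.inl he', ?_, g2.le, ?_⟩))⟩⟩
        · have := Move.col (G := G) x Y
          simpa [g1] using this
        · simp [he']
        · simp only [he', neg_add_cancel_right] at r2 ⊢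
          intro h1; rw [r2, if_pos h1.symm]
        · simp only at g2 ⊢
          rintro rfl; simp at g2
    · refine ⟨(x, Y), Move.refl _, ?_⟩
      simp only [RoadGuard, g1, Prod.mk.injEq, true_and]
      by_cases hy : y + σ = Y
      · left; exact hy.symm
      · refine Or.inr ⟨hY, Or.inr (Or.inl ?_)⟩
        rcases hσ with rfl | rfl <;> omega
  · rcases hrun with ⟨rfl, r1, r2⟩ | ⟨rfl, rfl⟩
    · by_cases he : G.row y = G.row Y
      · refine ⟨(x, Y), ?_, Or.inr ⟨hY, Or.inl ⟨?_, Or.inl he, ?_, g2⟩⟩⟩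
        · have := Move.col (G := G) x (Y + σ)
          simpa [g1] using this
        · simp [he]
        · simp only [he, add_sub_cancel_right] at r2 ⊢
          intro h1; rw [r2, if_pos h1.symm]
      · have he' : G.row y = -G.row Y := by omega
        refine ⟨(x, Y + σ), Move.refl _, Or.inr ⟨hY, Or.inr (Or.inr (Or.inr
          ⟨?_, Or.inl he', ?_, g2.le, ?_⟩))⟩⟩
        · simp [he']
        · simp only [he', neg_add_cancel_right] at r2 ⊢
          intro h1; rw [r2, if_pos h1.symm]
        · simp only at g2 ⊢
          rintro rfl; simp at g2
    · refine ⟨(x, Y + σ), Move.refl _, Or.inr ⟨hY, Or.inr (Or.inr (Or.inl ⟨rfl, g1, ?_⟩))⟩⟩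
      simp only [g1]
      rcases hσ with rfl | rfl <;> omega
  · have hc := G.col_eq (x + G.row Y)
    have hx := G.col_eq x
    have hmv : G.Move (x + G.row Y, Y + σ) (x, Y + σ) := by
      have := Move.row (G := G) (x + G.row Y) (Y + σ)
      simpa [hY] using this
    rcases hrun with ⟨rfl, r1, r2⟩ | ⟨rfl, rfl⟩
    · by_cases he : G.row y = G.row Y
      · have hne : G.col (x + G.row Y) ≠ G.col x := fun h1 => r1 (by rw [g2 h1, he])
        have hσx : G.col x = σ := g1.resolve_left (by omega)
        have hcol : G.col (x + G.row Y) = -σ := by omega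
        by_cases hy : y = Y
        · -- a robber in row `Y` runs into the cop's column, which leads the cop to him
          refine ⟨(x + G.row Y, Y), ?_, Or.inl ?_⟩
          · have := Move.col (G := G) (x + G.row Y) (Y + σ)
            simpa [hcol] using this
          · simp [hy]
        · refine ⟨_, Move.refl _, Or.inr ⟨hY, Or.inr (Or.inr (Or.inl ⟨?_, ?_, ?_⟩))⟩⟩
          · simp [he]
          · simp only [he]; exact hcol
          · simp only
            rcases hσ with rfl | rfl <;> omega
      · have he' : G.row y = -G.row Y := by omega
        refine ⟨_, hmv, Or.inr ⟨hY, Or.inr (Or.inr (Or.inr ⟨?_, Or.inl he', ?_, g3, ?_⟩))⟩⟩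
        · simp [he']
        · simp only [he', neg_add_cancel_right] at r2 ⊢
          intro h1; rw [r2, if_pos h1.symm]
        · simp only
          rintro rfl
          exact absurd he' (by omega)
    · by_cases he : G.col x = σ
      · by_cases hy : y = Y
        · -- a robber in row `Y` crosses to row `Y + σ` just in front of the cop
          exact ⟨_, hmv, Or.inl (by simp [hy, he])⟩
        · refine ⟨_, Move.refl _, Or.inr ⟨hY, Or.inr (Or.inr (Or.inr
            ⟨rfl, Or.inr he, g2, ?_, fun _ => he⟩))⟩⟩
          simp only [he]
          rcases hσ with rfl | rfl <;> omega
      · have he' : G.col x = -σ := by omega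
        refine ⟨_, hmv, Or.inr ⟨hY, Or.inr (Or.inr (Or.inl ⟨rfl, he', ?_⟩))⟩⟩
        simp only [he']
        have hy : y ≠ Y := fun hy => he (g4 hy)
        rcases hσ with rfl | rfl <;> omega

/-- The vertex of column `x` in the two rows `y` and `y + 1` at which a cop waits for the robber. -/
def roadPos (G : OrientedGrid) (y x : ℤ) : ℤ := if G.col x = 1 then y else y + 1

theorem roadPos_periodic (y : ℤ) : Function.Periodic (G.roadPos y) (G.n : ℤ) := fun x => by
  rw [roadPos, roadPos, G.col_periodic]

theorem roadGuard_below {y h : ℤ} {r : ℤ × ℤ} (hy : G.row y ≠ G.row (y + 1)) (hr : r.2 < y) :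
    G.RoadGuard 1 y (r.1, G.roadPos y r.1) r h := by
  have h1 := G.row_eq y
  have h2 := G.row_eq (y + 1)
  refine ⟨by omega, ?_⟩
  rcases G.col_eq r.1 with hc | hc
  · exact Or.inr (Or.inl ⟨by simp [roadPos, hc], hc, by omega⟩)
  · exact Or.inr (Or.inr (Or.inl ⟨by simp [roadPos, hc], hc, by omega⟩))

theorem roadGuard_above {y h : ℤ} {r : ℤ × ℤ} (hy : G.row y ≠ G.row (y + 1)) (hr : y + 1 < r.2) :
    G.RoadGuard (-1) (y + 1) (r.1, G.roadPos y r.1) r h := by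
  have h1 := G.row_eq y
  have h2 := G.row_eq (y + 1)
  refine ⟨by rw [add_neg_cancel_right]; omega, ?_⟩
  rcases G.col_eq r.1 with hc | hc
  · exact Or.inr (Or.inr (Or.inl ⟨by simp [roadPos, hc], by omega, by omega⟩))
  · exact Or.inr (Or.inl ⟨by simp [roadPos, hc], hc, by omega⟩)

/-- The cop at `roadPos` can reach the other vertex of the two rows in its column. -/
theorem roadPos_move {x y z : ℤ} (hz : z = y ∨ z = y + 1) :
    G.Move (x, G.roadPos y x) (x, z) := by
  have hm := Move.col (G := G) x (G.roadPos y x)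
  rcases G.col_eq x with hc | hc <;> simp only [roadPos, hc] at hm ⊢ <;>
    rcases hz with rfl | rfl
  · simpa using Move.refl _
  · simpa using hm
  · simpa using hm
  · simpa using Move.refl _

theorem roadPos_add_mul (y x j : ℤ) : G.roadPos y x + j * G.n = G.roadPos (y + j * G.n) x := by
  unfold roadPos; split_ifs <;> ring

/-- Seven cops suffice to catch a robber who neither stays nor makes detours. -/
theorem Evasion.not_of_card {S : Finset ι} {N : (ι → ℤ × ℤ) → ℤ × ℤ → ℤ → Prop}
    (hE : G.Evasion S N) (hS : 7 ≤ S.card) (c : ι → ℤ × ℤ) (r : ℤ × ℤ) (h : ℤ) : ¬ N c r h := by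
  by_cases hall : ∀ y, G.row y = G.row (y + 1)
  · have h0 : ∀ y, G.row y = G.row 0 := fun y => by
      induction y using Int.induction_on with
      | zero => rfl
      | succ i ih => rw [← hall, ih]
      | pred i ih => rw [hall, sub_add_cancel, ih]
    exact hE.not_of_row (by omega) (fun {_ r _} _ => h0 r.2) c r h
  push Not at hall
  obtain ⟨y, hy⟩ := hall
  have hn : (1 : ℤ) ≤ G.n := by exact_mod_cast G.n_pos
  refine hE.false_of_guards (by omega) (fun σ Y b r h => G.RoadGuard σ Y b r h)
    (@fun _ hσ _ _ _ _ _ _ _ _ hg hrun => hg.keep hσ hrun) (fun hg => hg.side)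
    ⟨G.roadPos y, roadPos_periodic y, ?_⟩ ?_ c r h
  · intro σ hσ r h
    have hab := abs_nonneg (y - r.2)
    have hle := le_abs_self (y - r.2)
    have hge := neg_abs_le (y - r.2)
    have hy' : ∀ j : ℤ, G.row (y + j * G.n) ≠ G.row (y + j * G.n + 1) := fun j => by
      rw [add_right_comm, row_add_mul, row_add_mul]; exact hy
    simp only [roadPos_add_mul]
    rcases hσ with rfl | rfl
    · exact ⟨|y - r.2| + 1, _, roadGuard_below (hy' _) (by nlinarith)⟩
    · exact ⟨-(|y - r.2| + 2), _, roadGuard_above (hy' _) (by nlinarith)⟩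
  · intro c r h Y₁ Y₂ i hi j hj hij H h1 h2
    by_cases hex : ∃ z, Y₂ ≤ z ∧ z < Y₁ ∧ G.row z ≠ G.row (z + 1)
    · obtain ⟨z, hz1, hz2, hz⟩ := hex
      refine ⟨G.roadPos z, roadPos_periodic z, fun r₁ t _ _ hfree => ?_⟩
      have hne : ¬ (r₁.2 = z ∨ r₁.2 = z + 1) := fun he => hfree _ (roadPos_move he) rfl
      rcases lt_or_ge r₁.2 z with hlt | hge
      · exact Or.inl ⟨z, hz2, roadGuard_below hz hlt⟩
      · exact Or.inr ⟨z + 1, by omega, roadGuard_above hz (by omega)⟩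
    · -- between the two guards all rows have the same direction
      push Not at hex
      exfalso
      have hrow : ∀ z, Y₂ ≤ z → z ≤ Y₁ → G.row z = G.row Y₂ := by
        intro z hz
        induction z, hz using Int.leInduction with
        | base => exact fun _ => rfl
        | succ z hz ih => exact fun hz' => (hex z hz (by omega)).symm.trans (ih (by omega))
      have hj' : j ∈ S.erase i := Finset.mem_erase.2 ⟨hij.symm, hj⟩
      have hE2 := (hE.restrict hi (G.RoadGuard 1 Y₁) fun _ hg hrun => hg.keep (Or.inl rfl) hrun)
        |>.restrict hj' (G.RoadGuard (-1) Y₂) fun _ hg hrun => hg.keep (Or.inr rfl) hrun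
      refine hE2.not_of_row (η := G.row Y₂) ?_ ?_ c r h ⟨⟨H, h1⟩, h2⟩
      · rw [Finset.card_erase_of_mem hj', Finset.card_erase_of_mem hi]; omega
      · rintro c r h ⟨⟨-, g1⟩, g2⟩
        have := g1.side
        have := g2.side
        exact hrow _ (by linarith) (by linarith)

end OrientedGrid

/-! ### The winning strategy on the torus -/

namespace OrientedGrid

/-- Nine cops win on every digraph that is covered by a periodically oriented grid, since they can
play the game on the grid. -/
theorem copsWin_nine (G : OrientedGrid) {V : Type*} (D : Digraph V) (proj : ℤ × ℤ → V)
    (hsurj : ∀ v, ∃ p, proj p = v) (hcong : ∀ {p q}, G.Cong p q → proj p = proj q)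
    (hmove : ∀ {p q}, G.Move p q → CopsRobber.Move D (proj p) (proj q))
    (hlift : ∀ {p v}, CopsRobber.Move D (proj p) v → ∃ q, G.Move p q ∧ proj q = v) :
    CopsRobber.CopsWin D 9 := by
  by_contra hwin
  let N : (Fin 9 → ℤ × ℤ) → ℤ × ℤ → Prop := fun c r => (∀ i, proj (c i) ≠ proj r) ∧
    ∃ r', G.Move r r' ∧ ¬ CopsRobber.WinFrom D (fun i => proj (c i)) (proj r')
  have hturn : ∀ {c : Fin 9 → ℤ × ℤ} {r}, ¬ CopsRobber.WinFrom D (fun i => proj (c i)) (proj r) →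
      ∀ c' : Fin 9 → ℤ × ℤ, (∀ i, G.Move (c i) (c' i)) → N c' r := by
    intro c r hw c' hc'
    refine ⟨fun i hi => hw (.capture (fun i => proj (c' i)) (fun i => hmove (hc' i)) i hi), ?_⟩
    by_contra hno
    refine hw (.round (fun i => proj (c' i)) (fun i => hmove (hc' i)) fun v hv => ?_)
    obtain ⟨q, h1, rfl⟩ := hlift hv
    by_contra hq
    exact hno ⟨q, h1, hq⟩
  have hstart : ∃ c r, N c r := by
    by_contra hno
    refine hwin ⟨fun _ => proj (0, 0), fun v => ?_⟩
    obtain ⟨r, rfl⟩ := hsurj v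
    by_contra hw
    exact hno ⟨_, r, hturn (c := fun _ => (0, 0)) hw _ fun _ => Move.refl _⟩
  obtain ⟨c, r, H⟩ := hstart
  obtain ⟨N', hE, c', r', h', H'⟩ := exists_evasion_of_pursuers (G := G) (N := N) (k := 0) (q := 1)
    (by decide) (fun H i hi => H.1 i (congrArg proj hi))
    (fun {c r} H c' hc' => by
      have : (fun i => proj (c' i)) = fun i => proj (c i) := funext fun i => (hcong (hc' i)).symm
      obtain ⟨h1, r', h2, h3⟩ := H
      exact ⟨fun i => by rw [← hcong (hc' i)]; exact h1 i, r', h2, by rw [this]; exact h3⟩)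
    (fun H => by
      obtain ⟨r', h1, h2⟩ := H.2
      exact ⟨r', h1, hturn h2⟩) H
  exact hE.not_of_card (by decide) c' r' h' H'

end OrientedGrid

/-! ### Classes of a dihedral pair of involutions -/

section Dihedral

variable {F : Type*} {p q : F → F} {m : ℕ}

/-- The members of the class of `z` under two involutions `p` and `q` whose product has order
`m`. -/
theorem exists_iterate_of_quot_eq (hp : ∀ x, p (p x) = x) (hq : ∀ x, q (q x) = x) (hm : 0 < m)
    (hper : ∀ x, Function.minimalPeriod (p ∘ q) x = m) {x z : F}
    (h : Quot.mk (fun a b => b = p a ∨ b = q a) x = Quot.mk (fun a b => b = p a ∨ b = q a) z) :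
    ∃ k < m, x = (p ∘ q)^[k] z ∨ x = q ((p ∘ q)^[k] z) := by
  have hback : ∀ k, ∃ k', p ((p ∘ q)^[k] z) = q ((p ∘ q)^[k'] z) := fun k => by
    refine ⟨k + (m - 1), ?_⟩
    have h1 : (p ∘ q)^[k] z = (p ∘ q)^[k + (m - 1) + 1] z := by
      rw [show k + (m - 1) + 1 = k + m by omega, Function.iterate_add_apply, ← hper z,
        Function.iterate_minimalPeriod]
    rw [h1, Function.iterate_succ_apply', Function.comp_apply, hp]
  let P : F → Prop := fun x => ∃ k : ℕ, x = (p ∘ q)^[k] z ∨ x = q ((p ∘ q)^[k] z)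
  have hPp : ∀ {x}, P x → P (p x) := by
    rintro x ⟨k, rfl | rfl⟩
    · exact (hback k).imp fun _ => Or.inr
    · exact ⟨k + 1, Or.inl (Function.iterate_succ_apply' (p ∘ q) k z).symm⟩
  have hPq : ∀ {x}, P x → P (q x) := by
    rintro x ⟨k, rfl | rfl⟩
    · exact ⟨k, Or.inr rfl⟩
    · exact ⟨k, Or.inl (hq _)⟩
  have hP : ∀ a b, (b = p a ∨ b = q a) → P a = P b := by
    rintro a b (rfl | rfl)
    · exact propext ⟨hPp, fun H => hp a ▸ hPp H⟩
    · exact propext ⟨hPq, fun H => hq a ▸ hPq H⟩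
  have hx : P x = P z := congrArg (Quot.lift P hP) h
  obtain ⟨k, hk⟩ : P x := hx ▸ ⟨0, Or.inl rfl⟩
  refine ⟨k % m, Nat.mod_lt _ hm, ?_⟩
  have := Function.iterate_mod_minimalPeriod_eq (f := p ∘ q) (x := z) (n := k)
  rw [hper] at this
  rwa [this]

/-- No power of `p ∘ q` agrees with `q` at any point: as `q` inverts `p ∘ q`, the point halfway
between would be fixed by `q` or by `p`. -/
theorem iterate_ne_of_involutions (hp : ∀ x, p (p x) = x) (hq : ∀ x, q (q x) = x)
    (hp' : ∀ x, p x ≠ x) (hq' : ∀ x, q x ≠ x) (k : ℕ) : ∀ z, (p ∘ q)^[k] z ≠ q z := by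
  induction k using Nat.twoStepInduction with
  | zero => exact fun z h => hq' z h.symm
  | one => exact fun z => hp' (q z)
  | more k ih _ =>
    intro z h
    apply ih (p (q z))
    have h1 : p (q ((p ∘ q)^[k] (p (q z)))) = q z := by
      have e : (p ∘ q)^[k + 2] z = p (q ((p ∘ q)^[k] (p (q z)))) := by
        rw [Function.iterate_succ_apply', Function.iterate_succ_apply]
        rfl
      rw [← e, h]
    calc (p ∘ q)^[k] (p (q z)) = q (p (p (q ((p ∘ q)^[k] (p (q z)))))) := by rw [hp, hq]
      _ = q (p (q z)) := by rw [h1]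

/-- The classes of two involutions without fixed points whose product has all orbits of length `m`
have `2 * m` elements each. -/
theorem card_quot_mul (hp : ∀ x, p (p x) = x) (hq : ∀ x, q (q x) = x)
    (hp' : ∀ x, p x ≠ x) (hq' : ∀ x, q x ≠ x) (hm : 0 < m)
    (hper : ∀ x, Function.minimalPeriod (p ∘ q) x = m) :
    Nat.card (Quot fun a b => b = p a ∨ b = q a) * (m * 2) = Nat.card F := by
  let mk : F → Quot fun a b => b = p a ∨ b = q a := Quot.mk _
  have hmkp : ∀ z, mk (p z) = mk z := fun z =>
    (Quot.sound (r := fun a b => b = p a ∨ b = q a) (Or.inl rfl)).symm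
  have hmkq : ∀ z, mk (q z) = mk z := fun z =>
    (Quot.sound (r := fun a b => b = p a ∨ b = q a) (Or.inr rfl)).symm
  have hmk : ∀ (k : ℕ) z, mk ((p ∘ q)^[k] z) = mk z := fun k z => by
    induction k with
    | zero => rfl
    | succ k ih =>
      rw [← ih, Function.iterate_succ_apply', Function.comp_apply, hmkp, hmkq]
  have hinj : ∀ {i j : ℕ} {z}, i < m → j < m → (p ∘ q)^[i] z = (p ∘ q)^[j] z → i = j :=
    fun {i j z} hi hj h => by
      have := Function.iterate_eq_iterate_iff_of_lt_minimalPeriod (f := p ∘ q) (x := z)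
        (by rwa [hper]) (by rwa [hper]) |>.1 h
      exact this
  have hne : ∀ {i j : ℕ} {z}, i < m → j < m → (p ∘ q)^[i] z ≠ (p ∘ q)^[j] (q z) := by
    intro i j z _ hj h
    apply iterate_ne_of_involutions hp hq hp' hq' (m - j + i) z
    rw [Function.iterate_add_apply, h, ← Function.iterate_add_apply,
      show m - j + j = m by omega, ← hper (q z), Function.iterate_minimalPeriod]
  have hswap : ∀ (k : ℕ) z, ∃ k', q ((p ∘ q)^[k] z) = (p ∘ q)^[k'] (q z) := fun k z => by
    have : mk (q ((p ∘ q)^[k] z)) = mk (q z) := by rw [hmkq, hmk, hmkq]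
    obtain ⟨k', -, h | h⟩ := exists_iterate_of_quot_eq hp hq hm hper this
    · exact ⟨k', h⟩
    · exfalso
      have h2 : (p ∘ q)^[k] z = (p ∘ q)^[k'] (q z) := by rw [← hq ((p ∘ q)^[k] z), h, hq]
      have h3 : (p ∘ q)^[k % m] z = (p ∘ q)^[k' % m] (q z) := by
        have e1 := Function.iterate_mod_minimalPeriod_eq (f := p ∘ q) (x := z) (n := k)
        have e2 := Function.iterate_mod_minimalPeriod_eq (f := p ∘ q) (x := q z) (n := k')
        rw [hper] at e1 e2
        rw [e1, e2, h2]
      exact hne (Nat.mod_lt _ hm) (Nat.mod_lt _ hm) h3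
  have hfib : ∀ v, Nonempty ({x // mk x = v} ≃ Fin m × Bool) := by
    intro v
    obtain ⟨z, rfl⟩ := Quot.exists_rep v
    let f : Fin m × Bool → {x // mk x = mk z} := fun t =>
      ⟨(p ∘ q)^[t.1] (if t.2 then q z else z), by
        rw [hmk]; split_ifs
        · exact hmkq z
        · rfl⟩
    refine ⟨(Equiv.ofBijective f ⟨?_, ?_⟩).symm⟩
    · rintro ⟨i, a⟩ ⟨j, b⟩ h
      have h' : (p ∘ q)^[i] (if a then q z else z) = (p ∘ q)^[j] (if b then q z else z) :=
        congrArg Subtype.val h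
      cases a <;> cases b <;> simp only [if_true, if_false, Bool.false_eq_true] at h'
      · rw [Fin.ext (hinj i.2 j.2 h')]
      · exact absurd h' (hne i.2 j.2)
      · exact absurd h'.symm (hne j.2 i.2)
      · rw [Fin.ext (hinj i.2 j.2 h')]
    · rintro ⟨x, hx⟩
      obtain ⟨k, hk, rfl | rfl⟩ := exists_iterate_of_quot_eq hp hq hm hper hx
      · exact ⟨(⟨k, hk⟩, false), Subtype.ext (by simp [f])⟩
      · obtain ⟨k', hk'⟩ := hswap k z
        refine ⟨(⟨k' % m, Nat.mod_lt _ hm⟩, true), Subtype.ext ?_⟩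
        have := Function.iterate_mod_minimalPeriod_eq (f := p ∘ q) (x := q z) (n := k')
        rw [hper] at this
        simpa [f, hk'] using this
  have e : F ≃ (Quot fun a b => b = p a ∨ b = q a) × (Fin m × Bool) :=
    (Equiv.sigmaFiberEquiv mk).symm.trans
      ((Equiv.sigmaCongrRight fun v => (hfib v).some).trans (Equiv.sigmaEquivProd _ _))
  rw [Nat.card_congr e, Nat.card_prod]
  simp

end Dihedral

/-! ### The grid covering of a four-regular quadrangulation -/

namespace SurfaceMap

variable {F : Type*} (M : SurfaceMap F)

theorem eulerChar_eq_zero (hreg : M.IsFourRegular) (hquad : M.IsQuadrangulation) :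
    M.eulerChar = 0 := by
  have hV : Nat.card M.Vertex * (4 * 2) = Nat.card F :=
    card_quot_mul M.flipE_flipE M.flipF_flipF M.flipE_ne M.flipF_ne (by norm_num) hreg
  have hFace : Nat.card M.Face * (4 * 2) = Nat.card F := by
    have := card_quot_mul M.flipE_flipE M.flipV_flipV M.flipE_ne M.flipV_ne (by norm_num) hquad
    simp only [or_comm] at this
    simpa only [Face, or_comm] using this
  have hE : Nat.card M.Edge * (2 * 2) = Nat.card F := by
    refine card_quot_mul M.flipV_flipV M.flipF_flipF M.flipV_ne M.flipF_ne (by norm_num) fun x => ?_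
    have h2 : Function.IsPeriodicPt (M.flipV ∘ M.flipF) 2 x := by
      change M.flipV (M.flipF (M.flipV (M.flipF x))) = x
      rw [M.flipV_flipF x, M.flipF_flipF, M.flipV_flipV]
    have h1 : ¬ Function.IsPeriodicPt (M.flipV ∘ M.flipF) 1 x := fun h => by
      apply M.flipV_ne_flipF (M.flipF x)
      rw [M.flipF_flipF]; exact h
    have hdvd := h2.minimalPeriod_dvd
    rcases (Nat.dvd_prime Nat.prime_two).1 hdvd with h | h
    · exact absurd (h ▸ Function.isPeriodicPt_minimalPeriod _ x) h1
    · exact h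
  unfold eulerChar
  omega

/-- `flipV` as a permutation of the flags. -/
def permV : Equiv.Perm F := Function.Involutive.toPerm M.flipV M.flipV_flipV

/-- `flipE` as a permutation of the flags. -/
def permE : Equiv.Perm F := Function.Involutive.toPerm M.flipE M.flipE_flipE

/-- `flipF` as a permutation of the flags. -/
def permF : Equiv.Perm F := Function.Involutive.toPerm M.flipF M.flipF_flipF

/-- The translation of a flag along its edge, in the square tiling of the universal cover. -/
def ahead : Equiv.Perm F := M.permE * M.permF * M.permE * M.permV

/-- The translation of a flag along the other edge of its corner. -/
def side : Equiv.Perm F := M.permF * M.permE * M.permV * M.permE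

theorem ahead_apply (x : F) : M.ahead x = M.flipE (M.flipF (M.flipE (M.flipV x))) := rfl

theorem side_apply (x : F) : M.side x = M.flipF (M.flipE (M.flipV (M.flipE x))) := rfl

theorem ahead_inv_apply (x : F) : M.ahead⁻¹ x = M.flipV (M.flipE (M.flipF (M.flipE x))) := by
  rw [Equiv.Perm.inv_eq_iff_eq, ahead_apply, M.flipV_flipV, M.flipE_flipE, M.flipF_flipF,
    M.flipE_flipE]

theorem side_inv_apply (x : F) : M.side⁻¹ x = M.flipE (M.flipV (M.flipE (M.flipF x))) := by
  rw [Equiv.Perm.inv_eq_iff_eq, side_apply, M.flipE_flipE, M.flipV_flipV, M.flipE_flipE,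
    M.flipF_flipF]

theorem flipE_side (x : F) : M.flipE (M.side x) = M.ahead (M.flipE x) := by
  rw [side_apply, ahead_apply]

variable {M}

theorem IsFourRegular.rotate_rotate (hreg : M.IsFourRegular) (x : F) :
    M.flipE (M.flipF (M.flipE (M.flipF x))) = M.flipF (M.flipE (M.flipF (M.flipE x))) := by
  have h : M.rotate^[4] x = x := by
    have := Function.iterate_minimalPeriod (f := M.rotate) (x := x); rwa [hreg x] at this
  have h' : M.flipE (M.flipF (M.flipE (M.flipF
    (M.flipE (M.flipF (M.flipE (M.flipF x))))))) = x := h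
  have h2 := congrArg (fun y => M.flipF (M.flipE (M.flipF (M.flipE y)))) h'
  simpa only [M.flipE_flipE, M.flipF_flipF] using h2

theorem IsQuadrangulation.faceStep_faceStep (hquad : M.IsQuadrangulation) (x : F) :
    M.flipE (M.flipV (M.flipE (M.flipV x))) = M.flipV (M.flipE (M.flipV (M.flipE x))) := by
  have h : M.faceStep^[4] x = x := by
    have := Function.iterate_minimalPeriod (f := M.faceStep) (x := x); rwa [hquad x] at this
  have h' : M.flipE (M.flipV (M.flipE (M.flipV
    (M.flipE (M.flipV (M.flipE (M.flipV x))))))) = x := h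
  have h2 := congrArg (fun y => M.flipV (M.flipE (M.flipV (M.flipE y)))) h'
  simpa only [M.flipE_flipE, M.flipV_flipV] using h2

theorem commute_ahead_side (hreg : M.IsFourRegular) (hquad : M.IsQuadrangulation) :
    Commute M.ahead M.side := by
  ext x
  simp only [Equiv.Perm.mul_apply, ahead_apply, side_apply]
  rw [M.flipV_flipF, ← hquad.faceStep_faceStep, hreg.rotate_rotate, M.flipE_flipE, M.flipE_flipE,
    M.flipV_flipF]

theorem straightAhead_eq (hreg : M.IsFourRegular) (x : F) :
    M.straightAhead x = M.flipF (M.ahead x) := hreg.rotate_rotate _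

theorem vertex_flipE (x : F) : M.vertex (M.flipE x) = M.vertex x :=
  (Quot.sound (r := fun a b => b = M.flipE a ∨ b = M.flipF a) (Or.inl rfl)).symm

theorem vertex_flipF (x : F) : M.vertex (M.flipF x) = M.vertex x :=
  (Quot.sound (r := fun a b => b = M.flipE a ∨ b = M.flipF a) (Or.inr rfl)).symm

theorem vertex_ahead (x : F) : M.vertex (M.ahead x) = M.vertex (M.flipV x) := by
  rw [ahead_apply, vertex_flipE, vertex_flipF, vertex_flipE]

theorem vertex_side (x : F) : M.vertex (M.side x) = M.vertex (M.flipV (M.flipE x)) := by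
  rw [side_apply, vertex_flipF, vertex_flipE]

theorem vertex_side_inv (x : F) :
    M.vertex (M.side⁻¹ x) = M.vertex (M.flipV (M.rotate x)) := by
  rw [side_inv_apply, vertex_flipE]; rfl

theorem flipV_rotate_rotate (hreg : M.IsFourRegular) (x : F) :
    M.flipV (M.rotate (M.rotate x)) = M.flipF (M.ahead⁻¹ x) := by
  rw [ahead_inv_apply, ← M.flipV_flipF]
  exact congrArg M.flipV (hreg.rotate_rotate x)

theorem rotate_rotate_rotate (hreg : M.IsFourRegular) (x : F) :
    M.rotate (M.rotate (M.rotate x)) = M.flipF (M.flipE x) := by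
  have := hreg.rotate_rotate (M.flipE (M.flipF x))
  rw [M.flipE_flipE, M.flipF_flipF] at this
  exact this

namespace Orientation

variable {o : M.Orientation}

theorem IsStraightAhead.out_ahead (ho : o.IsStraightAhead) (hreg : M.IsFourRegular) (x : F) :
    o.out (M.ahead x) ↔ o.out x := by
  have hfin := M.finite
  have hmap : Set.MapsTo M.ahead {x | o.out x} {x | o.out x} := fun x hx => by
    have := ho x hx 1
    rwa [Function.iterate_one, straightAhead_eq hreg, o.out_flipF] at this
  -- an injective map of a finite set into itself permutes this set
  refine ⟨fun h => ?_, fun h => hmap h⟩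
  have := Equiv.Perm.perm_symm_mapsTo_of_mapsTo M.ahead hmap h
  simpa using this

theorem IsStraightAhead.out_flipE_side (ho : o.IsStraightAhead) (hreg : M.IsFourRegular) (x : F) :
    o.out (M.flipE (M.side x)) ↔ o.out (M.flipE x) := by
  rw [flipE_side, ho.out_ahead hreg]

theorem IsStraightAhead.out_rotate (ho : o.IsStraightAhead) (hreg : M.IsFourRegular) (x : F) :
    o.out (M.rotate x) ↔ ¬ o.out (M.flipE x) := by
  have h := o.out_flipV (M.rotate x)
  have h2 := ho.out_flipE_side hreg (M.side⁻¹ x)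
  rw [← Equiv.Perm.mul_apply, mul_inv_cancel, Equiv.Perm.one_apply, side_inv_apply,
    M.flipE_flipE] at h2
  rw [h2]
  change _ ↔ ¬ o.out (M.flipV (M.rotate x))
  rw [h, not_not]

theorem IsStraightAhead.out_rotate_rotate (ho : o.IsStraightAhead) (hreg : M.IsFourRegular)
    (x : F) : o.out (M.rotate (M.rotate x)) ↔ ¬ o.out x := by
  have h := o.out_flipV (M.rotate (M.rotate x))
  rw [flipV_rotate_rotate hreg, o.out_flipF, ← ho.out_ahead hreg, Equiv.Perm.coe_inv,
    Equiv.apply_symm_apply] at h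
  rw [h, not_not]

end Orientation

theorem zpow_apply_iff {σ : Equiv.Perm F} {P : F → Prop} (h : ∀ x, P (σ x) ↔ P x) (i : ℤ) (x : F) :
    P ((σ ^ i) x) ↔ P x := by
  induction i using Int.induction_on with
  | zero => simp
  | succ i ih => rw [add_comm, zpow_add, zpow_one, Equiv.Perm.mul_apply, h, ih]
  | pred i ih =>
    rw [← ih, ← h ((σ ^ (-(i : ℤ) - 1)) x), ← Equiv.Perm.mul_apply, ← zpow_one_add]
    simp

/-- The flag over the point `p` of the grid, if the flag `x` is placed at the origin. -/
def gridFlag (M : SurfaceMap F) (x : F) (p : ℤ × ℤ) : F := (M.ahead ^ p.1 * M.side ^ p.2) x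

open Classical in
/-- The oriented grid that covers a four-regular quadrangulation with a straight-ahead orientation:
the universal cover of the surface, with the lifted orientation. -/
noncomputable def coveringGrid (o : M.Orientation) (x : F) : OrientedGrid where
  row j := if o.out ((M.side ^ j) x) then 1 else -1
  col i := if o.out (M.flipE ((M.ahead ^ i) x)) then 1 else -1
  n := orderOf M.ahead * orderOf M.side
  n_pos := by
    have := M.finite
    exact Nat.mul_pos (orderOf_pos _) (orderOf_pos _)
  row_eq _ := by split_ifs <;> simp
  col_eq _ := by split_ifs <;> simp
  row_periodic j := by
    simp only
    rw [zpow_add, zpow_natCast, mul_comm (orderOf _), pow_mul, pow_orderOf_eq_one, one_pow, mul_one]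
  col_periodic i := by
    simp only
    rw [zpow_add, zpow_natCast, pow_mul, pow_orderOf_eq_one, one_pow, mul_one]

theorem gridFlag_ahead (x : F) (p : ℤ × ℤ) :
    M.ahead (M.gridFlag x p) = M.gridFlag x (p.1 + 1, p.2) := by
  simp only [gridFlag]
  rw [← Equiv.Perm.mul_apply, ← mul_assoc, ← zpow_one_add, add_comm]

theorem gridFlag_ahead_inv (x : F) (p : ℤ × ℤ) :
    M.ahead⁻¹ (M.gridFlag x p) = M.gridFlag x (p.1 - 1, p.2) := by
  rw [Equiv.Perm.inv_eq_iff_eq, gridFlag_ahead]; simp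

theorem gridFlag_side (hreg : M.IsFourRegular) (hquad : M.IsQuadrangulation) (x : F) (p : ℤ × ℤ) :
    M.side (M.gridFlag x p) = M.gridFlag x (p.1, p.2 + 1) := by
  simp only [gridFlag]
  rw [← Equiv.Perm.mul_apply, ← mul_assoc,
    ← ((commute_ahead_side hreg hquad).zpow_left p.1).eq, mul_assoc, ← zpow_one_add, add_comm]

theorem gridFlag_side_inv (hreg : M.IsFourRegular) (hquad : M.IsQuadrangulation) (x : F)
    (p : ℤ × ℤ) : M.side⁻¹ (M.gridFlag x p) = M.gridFlag x (p.1, p.2 - 1) := by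
  rw [Equiv.Perm.inv_eq_iff_eq, gridFlag_side hreg hquad]; simp

theorem row_eq_one_iff (hreg : M.IsFourRegular) {o : M.Orientation} (ho : o.IsStraightAhead)
    (x : F) (p : ℤ × ℤ) : (coveringGrid o x).row p.2 = 1 ↔ o.out (M.gridFlag x p) := by
  rw [gridFlag, Equiv.Perm.mul_apply, zpow_apply_iff (ho.out_ahead hreg), coveringGrid]
  simp only
  split_ifs with h <;> simp [h]

theorem col_eq_one_iff (hreg : M.IsFourRegular) (hquad : M.IsQuadrangulation) {o : M.Orientation}
    (ho : o.IsStraightAhead) (x : F) (p : ℤ × ℤ) :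
    (coveringGrid o x).col p.1 = 1 ↔ o.out (M.flipE (M.gridFlag x p)) := by
  rw [gridFlag, ((commute_ahead_side hreg hquad).zpow_zpow p.1 p.2).eq, Equiv.Perm.mul_apply,
    zpow_apply_iff (P := fun z => o.out (M.flipE z)) (ho.out_flipE_side hreg), coveringGrid]
  simp only
  split_ifs with h <;> simp [h]

/-- The four edge ends at a vertex, up to the choice of a side of the edge, in the frame of one of
its flags: forward, sideways to the back, backward and sideways. -/
theorem exists_rotate_of_vertex_eq (hreg : M.IsFourRegular) {y z : F}
    (h : M.vertex y = M.vertex z) : ∃ w, (y = w ∨ y = M.flipF w) ∧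
      (w = z ∨ w = M.rotate z ∨ w = M.rotate (M.rotate z) ∨ w = M.flipF (M.flipE z)) := by
  obtain ⟨k, hk, h'⟩ := exists_iterate_of_quot_eq M.flipE_flipE M.flipF_flipF (by norm_num) hreg h
  refine ⟨_, h', ?_⟩
  interval_cases k
  · exact Or.inl rfl
  · exact Or.inr (Or.inl rfl)
  · exact Or.inr (Or.inr (Or.inl rfl))
  · exact Or.inr (Or.inr (Or.inr (rotate_rotate_rotate hreg z)))

/-- The vertex over a point of the grid. -/
def gridVertex (M : SurfaceMap F) (x : F) (p : ℤ × ℤ) : M.Vertex := M.vertex (M.gridFlag x p)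

theorem gridVertex_cong (o : M.Orientation) (x : F) {p q : ℤ × ℤ} (h : (coveringGrid o x).Cong p q) :
    M.gridVertex x p = M.gridVertex x q := by
  obtain ⟨a, b, rfl⟩ := h
  have h1 : M.ahead ^ (p.1 + a * (coveringGrid o x).n) = M.ahead ^ p.1 := by
    rw [zpow_add, mul_comm a, zpow_mul, zpow_natCast]
    simp only [coveringGrid]
    rw [pow_mul, pow_orderOf_eq_one, one_pow, one_zpow, mul_one]
  have h2 : M.side ^ (p.2 + b * (coveringGrid o x).n) = M.side ^ p.2 := by
    rw [zpow_add, mul_comm b, zpow_mul, zpow_natCast]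
    simp only [coveringGrid]
    rw [mul_comm (orderOf _), pow_mul, pow_orderOf_eq_one, one_pow, one_zpow, mul_one]
  simp only [gridVertex, gridFlag]
  rw [h1, h2]

theorem flipV_forward (x : F) (p : ℤ × ℤ) :
    M.vertex (M.flipV (M.gridFlag x p)) = M.gridVertex x (p.1 + 1, p.2) := by
  rw [gridVertex, ← gridFlag_ahead, vertex_ahead]

theorem flipV_backward (hreg : M.IsFourRegular) (x : F) (p : ℤ × ℤ) :
    M.vertex (M.flipV (M.rotate (M.rotate (M.gridFlag x p)))) = M.gridVertex x (p.1 - 1, p.2) := by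
  rw [flipV_rotate_rotate hreg, vertex_flipF, gridFlag_ahead_inv, gridVertex]

theorem flipV_sideways (hreg : M.IsFourRegular) (hquad : M.IsQuadrangulation) (x : F)
    (p : ℤ × ℤ) :
    M.vertex (M.flipV (M.flipF (M.flipE (M.gridFlag x p)))) = M.gridVertex x (p.1, p.2 + 1) := by
  rw [M.flipV_flipF, vertex_flipF, gridVertex, ← gridFlag_side hreg hquad, vertex_side]

theorem flipV_sideways_back (hreg : M.IsFourRegular) (hquad : M.IsQuadrangulation) (x : F)
    (p : ℤ × ℤ) :
    M.vertex (M.flipV (M.rotate (M.gridFlag x p))) = M.gridVertex x (p.1, p.2 - 1) := by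
  rw [gridVertex, ← gridFlag_side_inv hreg hquad, vertex_side_inv]

theorem exists_gridVertex (hreg : M.IsFourRegular) (hquad : M.IsQuadrangulation) (x : F)
    (v : M.Vertex) : ∃ p, M.gridVertex x p = v := by
  obtain ⟨y, rfl⟩ := Quot.exists_rep v
  change ∃ p, M.gridVertex x p = M.vertex y
  induction M.connected x y with
  | refl => exact ⟨(0, 0), by simp [gridVertex, gridFlag]⟩
  | @tail y z _ hyz ih =>
    obtain ⟨p, hp⟩ := ih
    rcases hyz with rfl | rfl | rfl
    · obtain ⟨w, hw, h⟩ := exists_rotate_of_vertex_eq hreg hp.symm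
      have hv : M.vertex (M.flipV y) = M.vertex (M.flipV w) := by
        rcases hw with rfl | rfl
        · rfl
        · rw [M.flipV_flipF, vertex_flipF]
      rw [hv]
      rcases h with rfl | rfl | rfl | rfl
      · exact ⟨_, (flipV_forward x p).symm⟩
      · exact ⟨_, (flipV_sideways_back hreg hquad x p).symm⟩
      · exact ⟨_, (flipV_backward hreg x p).symm⟩
      · exact ⟨_, (flipV_sideways hreg hquad x p).symm⟩
    · exact ⟨p, by rw [hp, vertex_flipE]⟩
    · exact ⟨p, by rw [hp, vertex_flipF]⟩

theorem move_gridVertex {o : M.Orientation} (hreg : M.IsFourRegular)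
    (hquad : M.IsQuadrangulation) (ho : o.IsStraightAhead) (x : F) {p q : ℤ × ℤ} (h : (coveringGrid o x).Move p q) :
    CopsRobber.Move o.toDigraph (M.gridVertex x p) (M.gridVertex x q) := by
  have hrot : ∀ z, M.vertex (M.rotate z) = M.vertex z := fun z =>
    (vertex_flipE _).trans (vertex_flipF _)
  rcases h with rfl | rfl | rfl
  · exact Or.inl rfl
  · by_cases hout : (coveringGrid o x).row p.2 = 1
    · rw [hout]
      exact Or.inr ⟨_, (row_eq_one_iff hreg ho x p).1 hout, rfl, flipV_forward x p⟩
    · rw [((coveringGrid o x).row_eq p.2).resolve_left hout]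
      refine Or.inr ⟨_, (ho.out_rotate_rotate hreg _).2 ?_, ?_, flipV_backward hreg x p⟩
      · rwa [← row_eq_one_iff hreg ho x p]
      · rw [hrot, hrot]; rfl
  · by_cases hout : (coveringGrid o x).col p.1 = 1
    · rw [hout]
      refine Or.inr ⟨_, ?_, ?_, flipV_sideways hreg hquad x p⟩
      · rw [o.out_flipF]; exact (col_eq_one_iff hreg hquad ho x p).1 hout
      · rw [vertex_flipF, vertex_flipE]; rfl
    · rw [((coveringGrid o x).col_eq p.1).resolve_left hout]
      refine Or.inr ⟨_, (ho.out_rotate hreg _).2 ?_, ?_, flipV_sideways_back hreg hquad x p⟩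
      · rwa [← col_eq_one_iff hreg hquad ho x p]
      · rw [hrot]; rfl

theorem exists_move_of_move {o : M.Orientation} (hreg : M.IsFourRegular)
    (hquad : M.IsQuadrangulation) (ho : o.IsStraightAhead) (x : F) {p : ℤ × ℤ} {v : M.Vertex}
    (h : CopsRobber.Move o.toDigraph (M.gridVertex x p) v) :
    ∃ q, (coveringGrid o x).Move p q ∧ M.gridVertex x q = v := by
  rcases h with rfl | ⟨y, hy, hyp, rfl⟩
  · exact ⟨p, Or.inl rfl, rfl⟩
  obtain ⟨w, hw, h⟩ := exists_rotate_of_vertex_eq hreg hyp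
  have hv : M.vertex (M.flipV y) = M.vertex (M.flipV w) := by
    rcases hw with rfl | rfl
    · rfl
    · rw [M.flipV_flipF, vertex_flipF]
  have hout : o.out w := by
    rcases hw with rfl | rfl
    · exact hy
    · rwa [o.out_flipF] at hy
  rw [hv]
  rcases h with rfl | rfl | rfl | rfl
  · rw [← row_eq_one_iff hreg ho] at hout
    exact ⟨(p.1 + 1, p.2), Or.inr (Or.inl (by rw [hout])), (flipV_forward x p).symm⟩
  · rw [ho.out_rotate hreg, ← col_eq_one_iff hreg hquad ho] at hout
    have := ((coveringGrid o x).col_eq p.1).resolve_left hout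
    exact ⟨(p.1, p.2 - 1), Or.inr (Or.inr (by rw [this]; rfl)),
      (flipV_sideways_back hreg hquad x p).symm⟩
  · rw [ho.out_rotate_rotate hreg, ← row_eq_one_iff hreg ho] at hout
    have := ((coveringGrid o x).row_eq p.2).resolve_left hout
    exact ⟨(p.1 - 1, p.2), Or.inr (Or.inl (by rw [this]; rfl)), (flipV_backward hreg x p).symm⟩
  · rw [o.out_flipF, ← col_eq_one_iff hreg hquad ho] at hout
    exact ⟨(p.1, p.2 + 1), Or.inr (Or.inr (by rw [hout])), (flipV_sideways hreg hquad x p).symm⟩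

end SurfaceMap

theorem theorem1 {F : Type*} (M : SurfaceMap F) (hreg : M.IsFourRegular)
    (hquad : M.IsQuadrangulation) :
    M.eulerChar = 0 ∧
      ∀ o : M.Orientation, o.IsStraightAhead → CopsRobber.copNumber o.toDigraph ≤ 319 := by
  refine ⟨M.eulerChar_eq_zero hreg hquad, fun o ho => ?_⟩
  obtain ⟨x⟩ := M.nonempty
  have h9 : CopsRobber.CopsWin o.toDigraph 9 :=
    (SurfaceMap.coveringGrid o x).copsWin_nine o.toDigraph (M.gridVertex x)
      (SurfaceMap.exists_gridVertex hreg hquad x) (SurfaceMap.gridVertex_cong o x)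
      (SurfaceMap.move_gridVertex hreg hquad ho x) (SurfaceMap.exists_move_of_move hreg hquad ho x)
  exact (iInf₂_le 9 h9).trans (by norm_num)
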